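/- For an integer $d\ge 1$, let $M_d$ be the algebra of complex $d\times d$ matrices. For $1\le p<\infty$ let $\|A\|_p=(\mathrm{Tr}\,|A|^p)^{1/p}$ be the Schatten norm, and for $Y\in M_m\otimes M_n$ put $$\|Y\|_{(\infty,p)}=\sup_{0\ne A,B\in M_m}\frac{\|(A\otimes I_n)\,Y\,(B\otimes I_n)\|_p}{\|A\|_{2p}\,\|B\|_{2p}},\qquad \|Y\|_{(1,p)}=\inf_{\substack{Y=(A\otimes I_n)Z(B\otimes I_n)\\ A,B\in M_m,\ Z\in M_m\otimes M_n}}\|A\|_2\,\|B\|_2\,\|Z\|_{(\infty,p)} .$$ Let $S(Q)=-\mathrm{Tr}\,Q\log Q$ be the von Neumann entropy (natural logarithm, $0\log 0=0$), and let $\mathrm{Tr}_2$ be the partial trace over $M_n$. **Theorem.** Let $X=X_{12}\in M_m\otimes M_n$ satisfy $X\ge 0$ and $\mathrm{Tr}\,X=1$, and let $X_1=\mathrm{Tr}_2X$. Then the function $p\mapsto\|X_{12}\|_{(1,p)}^p$, defined for $p\ge 1$, has a (right) derivative at $p=1$, and $$\frac{d}{dp}\,\|X_{12}\|_{(1,p)}^{\,p}\,\Big|_{p=1}=-S(X_{12})+S(X_1).$$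 -/

import Mathlib

open scoped Kronecker ComplexOrder

noncomputable section

namespace OperatorSpaceEntropy

/-- The absolute value `|A| = (A* A)^{1/2}` of a complex square matrix, through the functional
calculus (spectral decomposition) of the positive semidefinite matrix `A* A`. -/
def matAbs {ι : Type*} [Fintype ι] [DecidableEq ι] (A : Matrix ι ι ℂ) : Matrix ι ι ℂ :=
  cfc Real.sqrt (A.conjTranspose * A)

/-- The Schatten norm `‖A‖_p = (Tr |A|^p)^{1/p}` for a finite exponent `p`. -/
def schattenNorm {ι : Type*} [Fintype ι] [DecidableEq ι] (p : ℝ) (A : Matrix ι ι ℂ) : ℝ :=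
  ((cfc (fun x : ℝ => x ^ p) (matAbs A)).trace.re) ^ (1 / p)

/-- The norm of `L_∞(M_m; L_p(M_n))`:
`‖Y‖_{(∞,p)} = sup_{A, B ∈ M_m} ‖(A ⊗ I) Y (B ⊗ I)‖_p / (‖A‖_{2p} ‖B‖_{2p})`. -/
def normInfty {m n : ℕ} (p : ℝ) (Y : Matrix (Fin m × Fin n) (Fin m × Fin n) ℂ) : ℝ :=
  sSup {r : ℝ | ∃ A B : Matrix (Fin m) (Fin m) ℂ, A ≠ 0 ∧ B ≠ 0 ∧
    r = schattenNorm p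
          ((A ⊗ₖ (1 : Matrix (Fin n) (Fin n) ℂ)) * Y * (B ⊗ₖ (1 : Matrix (Fin n) (Fin n) ℂ)))
        / (schattenNorm (2 * p) A * schattenNorm (2 * p) B)}

/-- The norm of `L_t(M_m; L_p(M_n))` for finite `t`:
`‖Y‖_{(t,p)} = inf ‖A‖_{2t} ‖B‖_{2t} ‖Z‖_{(∞,p)}`, the infimum over all factorizations
`Y = (A ⊗ I) Z (B ⊗ I)` with `A, B ∈ M_m`. -/
def normLtLp {m n : ℕ} (t p : ℝ) (Y : Matrix (Fin m × Fin n) (Fin m × Fin n) ℂ) : ℝ :=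
  sInf {r : ℝ | ∃ (A B : Matrix (Fin m) (Fin m) ℂ) (Z : Matrix (Fin m × Fin n) (Fin m × Fin n) ℂ),
    Y = (A ⊗ₖ (1 : Matrix (Fin n) (Fin n) ℂ)) * Z * (B ⊗ₖ (1 : Matrix (Fin n) (Fin n) ℂ)) ∧
    r = schattenNorm (2 * t) A * schattenNorm (2 * t) B * normInfty p Z}

/-- The partial trace `X_1 = Tr_2 X` over the second tensor factor. -/
def partialTrace₂ {m n : ℕ} (X : Matrix (Fin m × Fin n) (Fin m × Fin n) ℂ) :
    Matrix (Fin m) (Fin m) ℂ :=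
  Matrix.of fun i k => ∑ j : Fin n, X (i, j) (k, j)

/-- The von Neumann entropy `S(Q) = - Tr Q log Q`, with `0 log 0 = 0` and the natural logarithm. -/
def vnEntropy {ι : Type*} [Fintype ι] [DecidableEq ι] (Q : Matrix ι ι ℂ) : ℝ :=
  -(cfc (fun x : ℝ => x * Real.log x) Q).trace.re

end OperatorSpaceEntropy

end

set_option linter.unusedSectionVars false

namespace OperatorSpaceEntropy

open Matrix

/-! ### Complex powers of nonnegative reals. -/

section WPow

/-! Write `L` for the claimed derivative and `N(p)` for the `(1,p)` norm of `X`. The function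
`N(p)^p` is squeezed for `p ≥ 1` between two explicit functions that both equal 1 at `p = 1` and
both have derivative `L` there: exp((p-1)L) ≤ N(p)^p ≤ Tr (X₁^(1-p) ⊗ I) X^p, where powers of `X₁`
are taken on its support.

Lower bound (`exp_le_of_factorization`). Take any factorization X = (A⊗I) Z (B⊗I), put e = 1 - 1/p,
and let F(z) = Tr (A^(1-z)⊗I) Z (B^(1-z)⊗I) X^z, the powers acting on singular values. Then F(0) =
1, |F| ≤ 1 on Re z = 0, and trace Hölder bounds |F| on Re z = e by the `(∞,p)` norm of `Z` times
(‖A‖₂‖B‖₂)^(1/p). The three lines theorem gives an exponential bound on [0,e] that is an equality at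
0, so it may be differentiated there. The derivative of F at 0 contains -Tr log|A*| X₁ and -Tr
log|B| X₁, and Klein's inequality (`trace_log_mul_le`) bounds these below by S(X₁)/2 minus the log
of the Hilbert–Schmidt norm. The norms of `A` and `B` then recombine into the cost ‖A‖₂‖B‖₂‖Z‖ of
the factorization.

Upper bound (`normLtLp_le_sum`, `sum_rpow_le`). With P = Tr₂ X^p, use A = B = P^(1/2p) and Z =
P^(-1/2p) X P^(-1/2p). A second interpolation (`schattenNorm_amp_mul_le`) shows that `Z` has `(∞,p)`
norm at most 1, so N(p) ≤ Tr P^(1/p). A Hölder inequality against `X₁` turns this into (Tr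
P^(1/p))^p ≤ Tr X₁^(1-p) P, which is the right-hand function above. -/

/-- The complex power `x ^ z` of a nonnegative real number, with value `0` at `x = 0`
for every exponent. -/
noncomputable def wpow (x : ℝ) (z : ℂ) : ℂ := if x = 0 then 0 else Complex.exp (z * Real.log x)

@[simp] lemma wpow_zero_left (z : ℂ) : wpow 0 z = 0 := by simp [wpow]

lemma wpow_ofReal {x : ℝ} (hx : 0 < x) (r : ℝ) : wpow x r = ((x ^ r : ℝ) : ℂ) := by
  rw [wpow, if_neg hx.ne', Real.rpow_def_of_pos hx]
  push_cast
  rw [mul_comm]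

lemma wpow_ofReal' {x : ℝ} (hx : 0 ≤ x) {r : ℝ} (hr : r ≠ 0) : wpow x r = ((x ^ r : ℝ) : ℂ) := by
  rcases hx.eq_or_lt with rfl | h
  · simp [Real.zero_rpow hr]
  · exact wpow_ofReal h r

lemma wpow_one {x : ℝ} (hx : 0 ≤ x) : wpow x 1 = x := by
  simpa using wpow_ofReal' hx one_ne_zero

/-- No restriction on the exponents is needed because 0^z = 0 even at z = 0. Hence negative powers
of a positive matrix are inverses on its support, and the zeroth power is the support projection. -/
lemma wpow_mul_wpow (x : ℝ) (z w : ℂ) : wpow x z * wpow x w = wpow x (z + w) := by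
  unfold wpow
  split_ifs
  · simp
  · rw [← Complex.exp_add, add_mul]

lemma star_wpow (x : ℝ) (z : ℂ) : star (wpow x z) = wpow x (star z) := by
  unfold wpow
  split_ifs
  · simp
  · simp only [Complex.star_def, ← Complex.exp_conj, map_mul, Complex.conj_ofReal]

lemma norm_wpow {x : ℝ} (hx : 0 < x) (z : ℂ) : ‖wpow x z‖ = x ^ z.re := by
  rw [wpow, if_neg hx.ne', Complex.norm_exp, Real.rpow_def_of_pos hx]
  simp [mul_comm]

lemma norm_wpow' {x : ℝ} (hx : 0 ≤ x) {z : ℂ} (hz : z.re ≠ 0) : ‖wpow x z‖ = x ^ z.re := by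
  rcases hx.eq_or_lt with rfl | h
  · simp [Real.zero_rpow hz]
  · exact norm_wpow h z

lemma norm_wpow_le {x : ℝ} (hx : 0 ≤ x) (z : ℂ) : ‖wpow x z‖ ≤ x ^ z.re := by
  rcases hx.eq_or_lt with rfl | h
  · simpa using Real.rpow_nonneg le_rfl _
  · exact (norm_wpow h z).le

lemma norm_wpow_le_one {x : ℝ} (hx : 0 ≤ x) {z : ℂ} (hz : z.re = 0) : ‖wpow x z‖ ≤ 1 := by
  simpa [hz] using norm_wpow_le hx z

lemma hasDerivAt_wpow (x : ℝ) (z : ℂ) : HasDerivAt (wpow x) (Real.log x * wpow x z) z := by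
  unfold wpow
  split_ifs with h
  · simpa using hasDerivAt_const z (0 : ℂ)
  · have := ((hasDerivAt_id z).mul_const (Real.log x : ℂ)).cexp
    simpa [mul_comm] using this

end WPow

/-! ### Diagonalization, singular values and matrix norms. -/

section Udv

variable {ι : Type*} [Fintype ι] [DecidableEq ι]

/-- The product `U diag(d) V*`. -/
def udv (U V : Matrix ι ι ℂ) (d : ι → ℂ) : Matrix ι ι ℂ := U * diagonal d * Vᴴ

lemma mem_unitary_iff {U : Matrix ι ι ℂ} : U ∈ unitaryGroup ι ℂ ↔ Uᴴ * U = 1 := by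
  rw [mem_unitaryGroup_iff', star_eq_conjTranspose]

lemma udv_mul_udv {V : Matrix ι ι ℂ} (hV : V ∈ unitaryGroup ι ℂ) (U W : Matrix ι ι ℂ)
    (d e : ι → ℂ) : udv U V d * udv V W e = udv U W (d * e) := by
  have h := mem_unitary_iff.1 hV
  calc udv U V d * udv V W e = U * diagonal d * (Vᴴ * V) * diagonal e * Wᴴ := by
        simp only [udv, Matrix.mul_assoc]
    _ = udv U W (d * e) := by
        rw [h, Matrix.mul_one, Matrix.mul_assoc U, diagonal_mul_diagonal]; rfl

lemma conjTranspose_udv (U V : Matrix ι ι ℂ) (d : ι → ℂ) : (udv U V d)ᴴ = udv V U (star d) := by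
  simp [udv, conjTranspose_mul, diagonal_conjTranspose, Matrix.mul_assoc]

lemma trace_udv_mul (U V : Matrix ι ι ℂ) (d : ι → ℂ) (K : Matrix ι ι ℂ) :
    (udv U V d * K).trace = ∑ i, d i * (Vᴴ * K * U) i i := by
  rw [udv, Matrix.mul_assoc, Matrix.mul_assoc, trace_mul_comm, Matrix.mul_assoc]
  simp [trace, diagonal_mul, Matrix.mul_assoc]

lemma trace_udv_self {U : Matrix ι ι ℂ} (hU : U ∈ unitaryGroup ι ℂ) (d : ι → ℂ) :
    (udv U U d).trace = ∑ i, d i := by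
  have := trace_udv_mul U U d 1
  rw [Matrix.mul_one, Matrix.mul_one, mem_unitary_iff.1 hU] at this
  simpa using this

lemma udv_neg (U V : Matrix ι ι ℂ) (d : ι → ℂ) : udv U V (-d) = -udv U V d := by
  have : diagonal (-d) = -diagonal d := by
    ext i j
    by_cases h : i = j <;> simp [h]
  rw [udv, udv, this, Matrix.mul_neg, Matrix.neg_mul]

lemma exists_udv_of_isHermitian {X : Matrix ι ι ℂ} (hX : X.IsHermitian) :
    ∃ U ∈ unitaryGroup ι ℂ, X = udv U U (fun i => (hX.eigenvalues i : ℂ)) ∧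
      ∀ f : ℝ → ℝ, cfc f X = udv U U (fun i => (f (hX.eigenvalues i) : ℂ)) := by
  refine ⟨hX.eigenvectorUnitary, hX.eigenvectorUnitary.2, ?_, fun f => ?_⟩
  · conv_lhs => rw [hX.spectral_theorem]
    rfl
  · rw [hX.cfc_eq]
    rfl

/-- For two diagonalizations of one matrix, the unitary `Wᴴ * U` intertwines the two diagonals, so
its (i,j) entry vanishes unless the eigenvalues agree. It therefore also intertwines their images
under `f`, which makes any diagonalization usable for the functional calculus. -/
lemma cfc_udv {U : Matrix ι ι ℂ} (hU : U ∈ unitaryGroup ι ℂ) (x : ι → ℝ) (f : ℝ → ℝ) :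
    cfc f (udv U U (fun i => (x i : ℂ))) = udv U U (fun i => (f (x i) : ℂ)) := by
  have hH : (udv U U (fun i => (x i : ℂ))).IsHermitian := by
    rw [Matrix.IsHermitian, conjTranspose_udv]
    congr 1
    ext i
    simp
  obtain ⟨W, hW, hX, hc⟩ := exists_udv_of_isHermitian hH
  rw [hc]
  set l := hH.eigenvalues
  have hUU : Uᴴ * U = 1 := mem_unitary_iff.1 hU
  have hUU' : U * Uᴴ = 1 := mem_unitaryGroup_iff.1 hU
  have hWW : Wᴴ * W = 1 := mem_unitary_iff.1 hW
  have hWW' : W * Wᴴ = 1 := mem_unitaryGroup_iff.1 hW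
  have key : (Wᴴ * U) * diagonal (fun i => (x i : ℂ)) =
      diagonal (fun i => (l i : ℂ)) * (Wᴴ * U) := by
    have h1 := congrArg (fun M => Wᴴ * M * U) hX
    simp only [udv] at h1
    calc (Wᴴ * U) * diagonal (fun i => (x i : ℂ))
        = Wᴴ * (U * diagonal (fun i => (x i : ℂ)) * Uᴴ) * U := by
          simp only [Matrix.mul_assoc, hUU, Matrix.mul_one]
      _ = (Wᴴ * W) * diagonal (fun i => (l i : ℂ)) * (Wᴴ * U) := by
          rw [h1]; simp only [Matrix.mul_assoc]
      _ = _ := by rw [hWW, Matrix.one_mul]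
  have key2 : (Wᴴ * U) * diagonal (fun i => (f (x i) : ℂ)) =
      diagonal (fun i => (f (l i) : ℂ)) * (Wᴴ * U) := by
    ext i j
    have h := congrFun (congrFun key i) j
    rw [mul_diagonal, diagonal_mul] at h ⊢
    by_cases h0 : (Wᴴ * U) i j = 0
    · simp [h0]
    · rw [mul_comm] at h
      have h2 := mul_right_cancel₀ h0 h
      have h3 : x j = l i := by exact_mod_cast h2
      rw [h3, mul_comm]
  calc udv W W (fun i => (f (l i) : ℂ))
      = W * (diagonal (fun i => (f (l i) : ℂ)) * (Wᴴ * U)) * Uᴴ := by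
        simp only [udv, Matrix.mul_assoc, hUU', Matrix.mul_one]
    _ = (W * Wᴴ) * U * diagonal (fun i => (f (x i) : ℂ)) * Uᴴ := by
        rw [← key2]; simp only [Matrix.mul_assoc]
    _ = _ := by rw [hWW', Matrix.one_mul]; rfl

lemma exists_udv_of_posSemidef {X : Matrix ι ι ℂ} (hX : X.PosSemidef) :
    ∃ U ∈ unitaryGroup ι ℂ, ∃ x : ι → ℝ, (∀ i, 0 ≤ x i) ∧ X = udv U U (fun i => (x i : ℂ)) := by
  obtain ⟨U, hU, h, -⟩ := exists_udv_of_isHermitian hX.1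
  exact ⟨U, hU, _, hX.eigenvalues_nonneg, h⟩

/-- Singular value decomposition of a complex square matrix. -/
lemma exists_svd (A : Matrix ι ι ℂ) :
    ∃ U ∈ unitaryGroup ι ℂ, ∃ V ∈ unitaryGroup ι ℂ, ∃ s : ι → ℝ, (∀ i, 0 ≤ s i) ∧
      A = udv U V (fun i => (s i : ℂ)) := by
  obtain ⟨V, hV, x, hx, h⟩ := exists_udv_of_posSemidef (posSemidef_conjTranspose_mul_self A)
  have hVV : Vᴴ * V = 1 := mem_unitary_iff.1 hV
  have hVV' : V * Vᴴ = 1 := mem_unitaryGroup_iff.1 hV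
  have hG : (A * V)ᴴ * (A * V) = diagonal (fun i => (x i : ℂ)) := by
    calc (A * V)ᴴ * (A * V) = Vᴴ * (Aᴴ * A) * V := by
          rw [conjTranspose_mul]; simp only [Matrix.mul_assoc]
      _ = (Vᴴ * V) * diagonal (fun i => (x i : ℂ)) * (Vᴴ * V) := by
          rw [h, udv]; simp only [Matrix.mul_assoc]
      _ = _ := by rw [hVV, Matrix.one_mul, Matrix.mul_one]
  have hinner : ∀ i j, ∑ k, star ((A * V) k i) * (A * V) k j = if i = j then (x i : ℂ) else 0 := by
    intro i j
    have := congrFun (congrFun hG i) j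
    rw [mul_apply, diagonal_apply] at this
    simpa [conjTranspose_apply] using this
  -- The columns of `A * V` are orthogonal with squared lengths `x i`. The nonzero ones are
  -- normalized and completed to an orthonormal basis, whose vectors are the columns of the left
  -- unitary.
  let v : ι → EuclideanSpace ℂ ι := fun i =>
    WithLp.toLp 2 (fun k => ((√(x i))⁻¹ : ℂ) * (A * V) k i)
  have hon : Orthonormal ℂ (({i | x i ≠ 0} : Set ι).domRestrict v) := by
    rw [orthonormal_iff_ite]
    rintro ⟨i, hi⟩ ⟨j, hj⟩
    have e : inner ℂ (v i) (v j) = ((√(x i))⁻¹ : ℂ) * ((√(x j))⁻¹ : ℂ) *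
        ∑ k, star ((A * V) k i) * (A * V) k j := by
      simp only [v, PiLp.inner_apply, Finset.mul_sum]
      refine Finset.sum_congr rfl fun k _ => ?_
      simp only [RCLike.inner_apply, map_mul, map_inv₀, Complex.conj_ofReal, Complex.star_def]
      ring
    simp only [Set.domRestrict_apply, Subtype.mk.injEq]
    rw [e, hinner]
    by_cases hij : i = j
    · subst hij
      have hxi : (0 : ℝ) < √(x i) := Real.sqrt_pos.2 (lt_of_le_of_ne (hx i) (Ne.symm hi))
      have h2 : (√(x i))⁻¹ * (√(x i))⁻¹ * x i = 1 := by
        nth_rewrite 3 [← Real.mul_self_sqrt (hx i)]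
        field_simp
      simp only [if_true]
      exact_mod_cast h2
    · simp [hij]
  obtain ⟨b, hb⟩ := hon.exists_orthonormalBasis_extension_of_card_eq (by simp)
  let U : Matrix ι ι ℂ := Matrix.of fun k i => b i k
  have hU : U ∈ unitaryGroup ι ℂ := by
    rw [mem_unitary_iff]
    ext i j
    have := orthonormal_iff_ite.1 b.orthonormal i j
    rw [PiLp.inner_apply] at this
    rw [mul_apply, Matrix.one_apply, ← this]
    refine Finset.sum_congr rfl fun k _ => ?_
    simp [U, conjTranspose_apply, mul_comm]
  have hAV : A * V = U * diagonal (fun i => ((√(x i) : ℝ) : ℂ)) := by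
    ext k i
    rw [mul_diagonal]
    by_cases hi : x i = 0
    · have h0 := hinner i i
      simp only [if_true, hi] at h0
      have h1 : ∑ k, ‖(A * V) k i‖ ^ 2 = 0 := by
        have : ((∑ k, ‖(A * V) k i‖ ^ 2 : ℝ) : ℂ) = 0 := by
          rw [← Complex.ofReal_zero, ← h0]
          push_cast
          refine Finset.sum_congr rfl fun k _ => ?_
          rw [Complex.star_def, Complex.conj_mul']
        exact_mod_cast this
      rw [Finset.sum_eq_zero_iff_of_nonneg (fun _ _ => by positivity)] at h1
      have := h1 k (Finset.mem_univ _)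
      have h3 : (A * V) k i = 0 := by simpa using this
      simp [h3, hi]
    · have h1 := hb i hi
      have hxi : (√(x i) : ℝ) ≠ 0 := (Real.sqrt_pos.2 (lt_of_le_of_ne (hx i) (Ne.symm hi))).ne'
      have hxi' : ((√(x i) : ℝ) : ℂ) ≠ 0 := by exact_mod_cast hxi
      simp only [U, Matrix.of_apply, h1, v]
      field_simp
  refine ⟨U, hU, V, hV, fun i => √(x i), fun i => Real.sqrt_nonneg _, ?_⟩
  rw [udv, ← hAV, Matrix.mul_assoc, hVV', Matrix.mul_one]

lemma matAbs_udv {U V : Matrix ι ι ℂ} (hU : U ∈ unitaryGroup ι ℂ) (hV : V ∈ unitaryGroup ι ℂ)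
    (d : ι → ℂ) : matAbs (udv U V d) = udv V V (fun i => (‖d i‖ : ℂ)) := by
  have : (udv U V d)ᴴ * udv U V d = udv V V (fun i => ((‖d i‖ ^ 2 : ℝ) : ℂ)) := by
    rw [conjTranspose_udv, udv_mul_udv hU]
    congr 1
    ext i
    simp [Complex.conj_mul']
  rw [matAbs, this, cfc_udv hV]
  simp

lemma schattenNorm_udv {U V : Matrix ι ι ℂ} (hU : U ∈ unitaryGroup ι ℂ)
    (hV : V ∈ unitaryGroup ι ℂ) (d : ι → ℂ) (p : ℝ) :
    schattenNorm p (udv U V d) = (∑ i, ‖d i‖ ^ p) ^ (1 / p) := by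
  rw [schattenNorm, matAbs_udv hU hV, cfc_udv hV, trace_udv_self hV]
  simp [← Complex.ofReal_sum]

lemma schattenNorm_nonneg (p : ℝ) (A : Matrix ι ι ℂ) : 0 ≤ schattenNorm p A := by
  obtain ⟨U, hU, V, hV, s, -, rfl⟩ := exists_svd A
  rw [schattenNorm_udv hU hV]
  positivity

lemma schattenNorm_zero {p : ℝ} (hp : 0 < p) : schattenNorm p (0 : Matrix ι ι ℂ) = 0 := by
  have h : (0 : Matrix ι ι ℂ) = udv 1 1 0 := by simp [udv]
  rw [h, schattenNorm_udv (one_mem _) (one_mem _)]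
  simp [Real.zero_rpow hp.ne', hp.ne']

lemma vnEntropy_udv {U : Matrix ι ι ℂ} (hU : U ∈ unitaryGroup ι ℂ) (x : ι → ℝ) :
    vnEntropy (udv U U (fun i => (x i : ℂ))) = -∑ i, x i * Real.log (x i) := by
  rw [vnEntropy, cfc_udv hU, trace_udv_self hU, ← Complex.ofReal_sum, Complex.ofReal_re]

/-! ### Operator norm and Hilbert–Schmidt estimates. -/

open scoped Matrix.Norms.L2Operator

lemma norm_unitary_le {U : Matrix ι ι ℂ} (hU : U ∈ unitaryGroup ι ℂ) : ‖U‖ ≤ 1 := by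
  have h := l2_opNorm_conjTranspose_mul_self U
  have h1 : ‖(1 : Matrix ι ι ℂ)‖ ≤ 1 := by
    rw [← diagonal_one, l2_opNorm_diagonal]
    exact (pi_norm_le_iff_of_nonneg zero_le_one).2 (by simp)
  rw [mem_unitary_iff.1 hU] at h
  nlinarith [norm_nonneg U]

lemma norm_conjTranspose_unitary_le {U : Matrix ι ι ℂ} (hU : U ∈ unitaryGroup ι ℂ) : ‖Uᴴ‖ ≤ 1 := by
  rw [l2_opNorm_conjTranspose]
  exact norm_unitary_le hU

lemma norm_mul_le_one {K L : Matrix ι ι ℂ} (hK : ‖K‖ ≤ 1) (hL : ‖L‖ ≤ 1) : ‖K * L‖ ≤ 1 :=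
  (norm_mul_le _ _).trans (mul_le_one₀ hK (norm_nonneg _) hL)

lemma norm_udv_le {U V : Matrix ι ι ℂ} (hU : U ∈ unitaryGroup ι ℂ) (hV : V ∈ unitaryGroup ι ℂ)
    {d : ι → ℂ} {c : ℝ} (hc : 0 ≤ c) (hd : ∀ i, ‖d i‖ ≤ c) : ‖udv U V d‖ ≤ c := by
  have h1 : ‖(diagonal d : Matrix ι ι ℂ)‖ ≤ c := by
    rw [l2_opNorm_diagonal]
    exact (pi_norm_le_iff_of_nonneg hc).2 hd
  calc ‖udv U V d‖ ≤ ‖U‖ * ‖(diagonal d : Matrix ι ι ℂ)‖ * ‖Vᴴ‖ := by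
        refine (norm_mul_le _ _).trans ?_
        gcongr
        exact norm_mul_le _ _
    _ ≤ 1 * c * 1 := by
        gcongr
        · exact norm_unitary_le hU
        · exact norm_conjTranspose_unitary_le hV
    _ = c := by ring

lemma norm_apply_le (K : Matrix ι ι ℂ) (i j : ι) : ‖K i j‖ ≤ ‖K‖ := by
  have h := l2_opNorm_mulVec K (EuclideanSpace.single j 1)
  have h2 : (EuclideanSpace.equiv ι ℂ).symm (K *ᵥ (EuclideanSpace.single j (1:ℂ))) i = K i j := by
    simp
  rw [← h2]
  refine (PiLp.norm_apply_le _ i).trans (h.trans ?_)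
  simp

/-- Duality of operator and trace norms: after cycling, each `d i` is weighted by a diagonal entry
of the contraction `Vᴴ * K * U`. -/
lemma norm_trace_mul_udv_le {U V : Matrix ι ι ℂ} (hU : U ∈ unitaryGroup ι ℂ)
    (hV : V ∈ unitaryGroup ι ℂ) {K : Matrix ι ι ℂ} (hK : ‖K‖ ≤ 1) (d : ι → ℂ) :
    ‖(K * udv U V d).trace‖ ≤ ∑ i, ‖d i‖ := by
  rw [trace_mul_comm, trace_udv_mul]
  refine (norm_sum_le _ _).trans (Finset.sum_le_sum fun i _ => ?_)
  rw [norm_mul]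
  refine mul_le_of_le_one_right (norm_nonneg _) ((norm_apply_le _ i i).trans ?_)
  exact norm_mul_le_one (norm_mul_le_one (norm_conjTranspose_unitary_le hV) hK) (norm_unitary_le hU)

/-- The squared Hilbert–Schmidt norm. -/
noncomputable def hs (M : Matrix ι ι ℂ) : ℝ := ∑ i, ∑ j, ‖M i j‖ ^ 2

lemma trace_mul_conjTranspose (M : Matrix ι ι ℂ) : (M * Mᴴ).trace = (hs M : ℂ) := by
  simp only [trace, diag_apply, mul_apply, conjTranspose_apply, hs, Complex.ofReal_sum]
  refine Finset.sum_congr rfl fun i _ => Finset.sum_congr rfl fun j _ => ?_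
  rw [Complex.star_def, Complex.mul_conj']
  simp

lemma hs_conjTranspose (M : Matrix ι ι ℂ) : hs Mᴴ = hs M := by
  rw [hs, hs, Finset.sum_comm]
  simp [conjTranspose_apply]

lemma eq_zero_of_hs_eq_zero {M : Matrix ι ι ℂ} (h : hs M = 0) : M = 0 := by
  ext i j
  rw [hs, Finset.sum_eq_zero_iff_of_nonneg (fun _ _ => by positivity)] at h
  have h1 := h i (Finset.mem_univ _)
  rw [Finset.sum_eq_zero_iff_of_nonneg (fun _ _ => by positivity)] at h1
  simpa using h1 j (Finset.mem_univ _)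

lemma hs_mul_le (M : Matrix ι ι ℂ) {K : Matrix ι ι ℂ} (hK : ‖K‖ ≤ 1) : hs (K * M) ≤ hs M := by
  have hcol : ∀ N : Matrix ι ι ℂ, hs N = ∑ j, ‖WithLp.toLp 2 (fun i => N i j)‖ ^ 2 := by
    intro N
    rw [hs, Finset.sum_comm]
    refine Finset.sum_congr rfl fun j _ => ?_
    rw [EuclideanSpace.norm_sq_eq]
  rw [hcol, hcol]
  refine Finset.sum_le_sum fun j _ => ?_
  have h := l2_opNorm_mulVec K (WithLp.toLp 2 (fun i => M i j))
  refine pow_le_pow_left₀ (norm_nonneg _) (h.trans ?_) 2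
  exact mul_le_of_le_one_left (norm_nonneg _) hK

lemma hs_mul_le' (M : Matrix ι ι ℂ) {K : Matrix ι ι ℂ} (hK : ‖K‖ ≤ 1) : hs (M * K) ≤ hs M := by
  rw [← hs_conjTranspose, conjTranspose_mul, ← hs_conjTranspose M]
  exact hs_mul_le _ (by rwa [l2_opNorm_conjTranspose])

lemma hs_udv {U V : Matrix ι ι ℂ} (hU : U ∈ unitaryGroup ι ℂ) (hV : V ∈ unitaryGroup ι ℂ)
    (d : ι → ℂ) : hs (udv U V d) = ∑ i, ‖d i‖ ^ 2 := by
  have h := trace_mul_conjTranspose (udv U V d)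
  rw [conjTranspose_udv, udv_mul_udv hV, trace_udv_self hU] at h
  have h2 : ((hs (udv U V d) : ℝ) : ℂ) = ((∑ i, ‖d i‖ ^ 2 : ℝ) : ℂ) := by
    rw [← h]
    push_cast
    refine Finset.sum_congr rfl fun i _ => ?_
    simp [Complex.mul_conj']
  exact_mod_cast h2

lemma norm_trace_mul_le (M N : Matrix ι ι ℂ) : ‖(M * N).trace‖ ≤ √(hs M) * √(hs N) := by
  have h : (M * N).trace = ∑ q : ι × ι, M q.1 q.2 * N q.2 q.1 := by
    simp only [trace, diag_apply, mul_apply, Fintype.sum_prod_type]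
  have hM : hs M = ∑ q : ι × ι, ‖M q.1 q.2‖ ^ 2 := by
    simp only [hs, Fintype.sum_prod_type]
  have hN : hs N = ∑ q : ι × ι, ‖N q.2 q.1‖ ^ 2 := by
    rw [← hs_conjTranspose]
    simp [hs, Fintype.sum_prod_type, conjTranspose_apply]
  rw [h, hM, hN]
  refine (norm_sum_le _ _).trans ?_
  simp only [norm_mul]
  exact Real.sum_mul_le_sqrt_mul_sqrt _ _ _

end Udv

open scoped Matrix.Norms.L2Operator

/-! ### Hölder inequalities. -/

section Holder

/-- Weighted Hölder with exponents 1/t and 1/(1-t), obtained termwise from weighted AM–GM applied to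
u/G and v. Both matrix Hölder inequalities reduce to it once traces are expanded in eigenbases. -/
lemma sum_weighted_rpow_le {κ : Type*} [Fintype κ] {c u v : κ → ℝ} (hc : ∀ i, 0 ≤ c i)
    (hu : ∀ i, 0 ≤ u i) (hv : ∀ i, 0 ≤ v i) {G t : ℝ} (ht : 0 < t) (ht1 : t ≤ 1)
    (hG : ∑ i, c i * u i ≤ G) (hv1 : ∑ i, c i * v i ≤ 1) :
    ∑ i, c i * (u i ^ t * v i ^ (1 - t)) ≤ G ^ t := by
  have hG0 : 0 ≤ G := (Finset.sum_nonneg fun i _ => mul_nonneg (hc i) (hu i)).trans hG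
  rcases hG0.eq_or_lt with rfl | hG0
  · have h0 := le_antisymm hG (Finset.sum_nonneg fun i _ => mul_nonneg (hc i) (hu i))
    rw [Finset.sum_eq_zero_iff_of_nonneg fun i _ => mul_nonneg (hc i) (hu i)] at h0
    rw [Real.zero_rpow ht.ne']
    refine (Finset.sum_eq_zero fun i hi => ?_).le
    rcases mul_eq_zero.1 (h0 i hi) with h | h
    · simp [h]
    · simp [h, Real.zero_rpow ht.ne']
  · have hterm : ∀ i, c i * (u i ^ t * v i ^ (1 - t)) ≤
        G ^ t * (t / G * (c i * u i) + (1 - t) * (c i * v i)) := by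
      intro i
      have h := Real.geom_mean_le_arith_mean2_weighted ht.le (sub_nonneg.2 ht1)
        (div_nonneg (hu i) hG0.le) (hv i) (by ring)
      rw [Real.div_rpow (hu i) hG0.le] at h
      have hGt : 0 < G ^ t := Real.rpow_pos_of_pos hG0 t
      calc c i * (u i ^ t * v i ^ (1 - t))
          = c i * G ^ t * (u i ^ t / G ^ t * v i ^ (1 - t)) := by field_simp
        _ ≤ c i * G ^ t * (t * (u i / G) + (1 - t) * v i) := by
            have := mul_nonneg (hc i) hGt.le
            gcongr
        _ = _ := by ring
    calc ∑ i, c i * (u i ^ t * v i ^ (1 - t))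
        ≤ ∑ i, G ^ t * (t / G * (c i * u i) + (1 - t) * (c i * v i)) :=
          Finset.sum_le_sum fun i _ => hterm i
      _ = G ^ t * (t / G * ∑ i, c i * u i + (1 - t) * ∑ i, c i * v i) := by
          rw [← Finset.mul_sum, Finset.sum_add_distrib, Finset.mul_sum, Finset.mul_sum]
      _ ≤ G ^ t * (t / G * G + (1 - t) * 1) := by
          have h1 : 0 ≤ 1 - t := sub_nonneg.2 ht1
          gcongr
      _ = G ^ t := by field_simp; ring

variable {ι : Type*} [Fintype ι] [DecidableEq ι]

lemma sum_norm_sq_col {W : Matrix ι ι ℂ} (hW : W ∈ unitaryGroup ι ℂ) (j : ι) :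
    ∑ i, ‖W i j‖ ^ 2 = 1 := by
  have h := congrFun (congrFun (mem_unitary_iff.1 hW) j) j
  rw [mul_apply, one_apply_eq] at h
  have : ((∑ i, ‖W i j‖ ^ 2 : ℝ) : ℂ) = 1 := by
    rw [← h]
    push_cast
    refine Finset.sum_congr rfl fun k _ => ?_
    rw [conjTranspose_apply, Complex.star_def, Complex.conj_mul']
  exact_mod_cast this

lemma conjTranspose_mem_unitary {W : Matrix ι ι ℂ} (hW : W ∈ unitaryGroup ι ℂ) :
    Wᴴ ∈ unitaryGroup ι ℂ := by
  rw [mem_unitary_iff, conjTranspose_conjTranspose]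
  exact mem_unitaryGroup_iff.1 hW

lemma sum_norm_sq_row {W : Matrix ι ι ℂ} (hW : W ∈ unitaryGroup ι ℂ) (i : ι) :
    ∑ j, ‖W i j‖ ^ 2 = 1 := by
  simpa [conjTranspose_apply] using sum_norm_sq_col (conjTranspose_mem_unitary hW) i

lemma sum_mul_le_one_of_unitary {f g : ι → ℝ}
    (h1 : ∑ i, f i ^ 2 = 1) (h2 : ∑ i, g i ^ 2 = 1) : ∑ i, f i * g i ≤ 1 := by
  have := Real.sum_mul_le_sqrt_mul_sqrt Finset.univ f g
  rwa [h1, h2, Real.sqrt_one, mul_one] at this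

/-- Hölder's inequality for the trace, tested against a contractive complex power. -/
lemma norm_trace_mul_udv_le_schattenNorm (Y : Matrix ι ι ℂ) {U : Matrix ι ι ℂ}
    (hU : U ∈ unitaryGroup ι ℂ) {x : ι → ℝ} (hx : ∀ i, 0 ≤ x i) (hx1 : ∑ i, x i ≤ 1)
    {p : ℝ} (hp : 1 ≤ p) {z : ℂ} (hz : z.re = 1 - 1 / p) :
    ‖(Y * udv U U (fun i => wpow (x i) z)).trace‖ ≤ schattenNorm p Y := by
  obtain ⟨S, hS, T, hT, s, hs0, rfl⟩ := exists_svd Y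
  have hp0 : 0 < p := by linarith
  rw [schattenNorm_udv hS hT]
  set a : Matrix ι ι ℂ := Tᴴ * U
  set b : Matrix ι ι ℂ := Uᴴ * S
  have ha : a ∈ unitaryGroup ι ℂ := mul_mem (conjTranspose_mem_unitary hT) hU
  have hb : b ∈ unitaryGroup ι ℂ := mul_mem (conjTranspose_mem_unitary hU) hS
  have htr : (udv S T (fun i => (s i : ℂ)) * udv U U (fun i => wpow (x i) z)).trace =
      ∑ q : ι × ι, (s q.1 : ℂ) * (a q.1 q.2 * wpow (x q.2) z * b q.2 q.1) := by
    rw [trace_udv_mul, Fintype.sum_prod_type]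
    refine Finset.sum_congr rfl fun i _ => ?_
    have : Tᴴ * udv U U (fun i => wpow (x i) z) * S = a * diagonal (fun i => wpow (x i) z) * b := by
      simp only [udv, a, b, Matrix.mul_assoc]
    rw [this, mul_apply, Finset.mul_sum]
    refine Finset.sum_congr rfl fun j _ => ?_
    rw [mul_diagonal]
  have hsimp : ∀ i, ‖(s i : ℂ)‖ = s i := fun i => by simp [abs_of_nonneg (hs0 i)]
  have hrow : ∀ i, ∑ j, ‖a i j‖ * ‖b j i‖ ≤ 1 := fun i =>
    sum_mul_le_one_of_unitary (sum_norm_sq_row ha i) (sum_norm_sq_col hb i)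
  have hcol : ∀ j, ∑ i, ‖a i j‖ * ‖b j i‖ ≤ 1 := fun j =>
    sum_mul_le_one_of_unitary (sum_norm_sq_col ha j) (sum_norm_sq_row hb j)
  rw [htr]
  refine (norm_sum_le _ _).trans ?_
  -- By Cauchy–Schwarz on rows and columns of the unitaries, the weights ‖a i j‖‖b j i‖ are doubly
  -- substochastic, which gives both hypotheses of the scalar inequality.
  have key := sum_weighted_rpow_le (κ := ι × ι) (c := fun q => ‖a q.1 q.2‖ * ‖b q.2 q.1‖)
    (u := fun q => s q.1 ^ p) (v := fun q => x q.2) (G := ∑ i, s i ^ p) (t := 1 / p)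
    (fun _ => by positivity) (fun q => Real.rpow_nonneg (hs0 _) _) (fun q => hx _)
    (by positivity) (by rw [div_le_one hp0]; exact hp) ?_ ?_
  · simp only [hsimp]
    refine le_trans (Finset.sum_le_sum fun q _ => ?_) key
    rw [← Real.rpow_mul (hs0 _), mul_one_div_cancel hp0.ne', Real.rpow_one]
    simp only [norm_mul, hsimp]
    have := norm_wpow_le (hx q.2) z
    rw [hz] at this
    have h0 := hs0 q.1
    calc s q.1 * (‖a q.1 q.2‖ * ‖wpow (x q.2) z‖ * ‖b q.2 q.1‖)
        ≤ s q.1 * (‖a q.1 q.2‖ * x q.2 ^ (1 - 1 / p) * ‖b q.2 q.1‖) := by gcongr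
      _ = _ := by ring
  · rw [Fintype.sum_prod_type]
    refine Finset.sum_le_sum fun i _ => ?_
    dsimp only
    rw [← Finset.sum_mul]
    exact mul_le_of_le_one_left (Real.rpow_nonneg (hs0 _) _) (hrow i)
  · refine le_trans ?_ hx1
    rw [Fintype.sum_prod_type, Finset.sum_comm]
    refine Finset.sum_le_sum fun j _ => ?_
    dsimp only
    rw [← Finset.sum_mul]
    exact mul_le_of_le_one_left (hx _) (hcol j)

end Holder

/-! ### Klein's inequality. -/

section Klein

variable {ι : Type*} [Fintype ι] [DecidableEq ι]

lemma mul_log_sub_log_le {a x : ℝ} (ha : 0 < a) (hx : 0 < x) :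
    x * (Real.log a - Real.log x) ≤ a - x := by
  have h := Real.log_le_sub_one_of_pos (div_pos ha hx)
  rw [Real.log_div ha.ne' hx.ne'] at h
  calc x * (Real.log a - Real.log x) ≤ x * (a / x - 1) := by gcongr
    _ = a - x := by field_simp

/-- Klein's inequality for the singular values of a factor whose range contains that of the
state. -/
lemma trace_log_mul_le {U V : Matrix ι ι ℂ} (hU : U ∈ unitaryGroup ι ℂ)
    (hV : V ∈ unitaryGroup ι ℂ) {a x : ι → ℝ} (ha : ∀ i, 0 ≤ a i) (hx : ∀ i, 0 ≤ x i)
    (hx1 : ∑ i, x i = 1)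
    (hsupp : ∀ i, a i = 0 → ∀ j, (Uᴴ * udv V V (fun i => (x i : ℂ))) i j = 0) :
    (udv U U (fun i => (Real.log (a i) : ℂ)) * udv V V (fun i => (x i : ℂ))).trace.re ≤
      1 / 2 * ∑ i, x i * Real.log (x i) + 1 / 2 * Real.log (∑ i, a i ^ 2) := by
  set W : Matrix ι ι ℂ := Uᴴ * V with hWdef
  have hW : W ∈ unitaryGroup ι ℂ := mul_mem (conjTranspose_mem_unitary hU) hV
  have hVV : Vᴴ * V = 1 := mem_unitary_iff.1 hV
  have hWx : ∀ i j, a i = 0 → ‖W i j‖ ^ 2 * x j = 0 := by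
    intro i j hi
    have h : (W * diagonal (fun i => (x i : ℂ))) i j = 0 := by
      have e : W * diagonal (fun i => (x i : ℂ)) = Uᴴ * udv V V (fun i => (x i : ℂ)) * V := by
        simp only [udv, Matrix.mul_assoc, hVV, Matrix.mul_one, hWdef]
      rw [e, mul_apply]
      exact Finset.sum_eq_zero fun k _ => by rw [hsupp i hi k, zero_mul]
    rw [mul_diagonal] at h
    rcases mul_eq_zero.1 h with h | h
    · simp [h]
    · have : x j = 0 := by exact_mod_cast h
      simp [this]
  have htr : (udv U U (fun i => (Real.log (a i) : ℂ)) * udv V V (fun i => (x i : ℂ))).trace.re =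
      ∑ i, ∑ j, ‖W i j‖ ^ 2 * x j * Real.log (a i) := by
    have : (udv U U (fun i => (Real.log (a i) : ℂ)) * udv V V (fun i => (x i : ℂ))).trace =
        ((∑ i, ∑ j, ‖W i j‖ ^ 2 * x j * Real.log (a i) : ℝ) : ℂ) := by
      rw [trace_udv_mul]
      push_cast
      refine Finset.sum_congr rfl fun i _ => ?_
      have e : Uᴴ * udv V V (fun i => (x i : ℂ)) * U = W * diagonal (fun i => (x i : ℂ)) * Wᴴ := by
        simp only [udv, hWdef, conjTranspose_mul, conjTranspose_conjTranspose, Matrix.mul_assoc]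
      rw [e, mul_apply, Finset.mul_sum]
      refine Finset.sum_congr rfl fun j _ => ?_
      rw [mul_diagonal, conjTranspose_apply, ← Complex.mul_conj', Complex.star_def]
      ring
    rw [this, Complex.ofReal_re]
  set N := ∑ i, a i ^ 2 with hN
  -- If every `a i` vanished, the support condition would annihilate all of the mass of `x`, which
  -- is 1.
  have hN0 : 0 < N := by
    by_contra hcon
    have h0 : N = 0 := le_antisymm (not_lt.1 hcon) (Finset.sum_nonneg fun _ _ => by positivity)
    rw [hN, Finset.sum_eq_zero_iff_of_nonneg fun _ _ => by positivity] at h0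
    have h1 : ∑ j, ∑ i, ‖W i j‖ ^ 2 * x j = 0 :=
      Finset.sum_eq_zero fun j _ => Finset.sum_eq_zero fun i _ =>
        hWx i j (by simpa using h0 i (Finset.mem_univ _))
    have h2 : ∑ j, ∑ i, ‖W i j‖ ^ 2 * x j = 1 := by
      rw [← hx1]
      refine Finset.sum_congr rfl fun j _ => ?_
      rw [← Finset.sum_mul, sum_norm_sq_col hW, one_mul]
    linarith
  -- The scalar inequality x(log a - log x) ≤ a - x is used with a i ^ 2 / N in place of a. The last
  -- bracket sums to zero, since both a² / N and x have total mass 1. The cases x j = 0 and a i = 0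
  -- rely on the support condition and on log 0 = 0.
  have hterm : ∀ i j, ‖W i j‖ ^ 2 * x j * Real.log (a i) ≤
      1 / 2 * (‖W i j‖ ^ 2 * (x j * Real.log (x j))) + 1 / 2 * Real.log N * (‖W i j‖ ^ 2 * x j) +
        1 / 2 * (‖W i j‖ ^ 2 * (a i ^ 2 / N) - ‖W i j‖ ^ 2 * x j) := by
    intro i j
    rcases (hx j).eq_or_lt with h | hxj
    · simp only [← h]
      have : 0 ≤ ‖W i j‖ ^ 2 * (a i ^ 2 / N) := by positivity
      simp
      linarith
    rcases (ha i).eq_or_lt with h | hai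
    · have h0 := hWx i j h.symm
      have hw : ‖W i j‖ ^ 2 = 0 := by
        rcases mul_eq_zero.1 h0 with h | h
        · exact h
        · exact absurd h hxj.ne'
      simp [hw]
    · have h := mul_log_sub_log_le (div_pos (pow_pos hai 2) hN0) hxj
      rw [Real.log_div (pow_pos hai 2).ne' hN0.ne', Real.log_pow] at h
      have := mul_le_mul_of_nonneg_left h (by positivity : 0 ≤ 1 / 2 * ‖W i j‖ ^ 2)
      push_cast at this
      linarith
  have s1 : ∀ f : ι → ℝ, ∑ i, ∑ j, ‖W i j‖ ^ 2 * f j = ∑ j, f j := by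
    intro f
    rw [Finset.sum_comm]
    refine Finset.sum_congr rfl fun j _ => ?_
    rw [← Finset.sum_mul, sum_norm_sq_col hW, one_mul]
  have s2 : ∀ f : ι → ℝ, ∑ i, ∑ j, ‖W i j‖ ^ 2 * f i = ∑ j, f j := by
    intro f
    refine Finset.sum_congr rfl fun j _ => ?_
    rw [← Finset.sum_mul, sum_norm_sq_row hW, one_mul]
  rw [htr]
  refine (Finset.sum_le_sum fun i _ => Finset.sum_le_sum fun j _ => hterm i j).trans ?_
  simp only [Finset.sum_add_distrib, Finset.sum_sub_distrib, ← Finset.mul_sum]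
  rw [s1 (fun j => x j * Real.log (x j)), s1 x, s2 (fun i => a i ^ 2 / N), hx1,
    ← Finset.sum_div, ← hN, div_self hN0.ne']
  linarith

end Klein

/-! ### Amplification and partial trace. -/

section Kron

variable {m n : ℕ}

/-- The amplification `A ⊗ I`. -/
def amp (n : ℕ) {m : ℕ} (A : Matrix (Fin m) (Fin m) ℂ) :
    Matrix (Fin m × Fin n) (Fin m × Fin n) ℂ := A ⊗ₖ (1 : Matrix (Fin n) (Fin n) ℂ)

lemma amp_mul (A B : Matrix (Fin m) (Fin m) ℂ) : amp n (A * B) = amp n A * amp n B := by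
  simp [amp, ← mul_kronecker_mul]

lemma amp_one : amp n (1 : Matrix (Fin m) (Fin m) ℂ) = 1 := by simp [amp]

lemma amp_sub (A B : Matrix (Fin m) (Fin m) ℂ) : amp n (A - B) = amp n A - amp n B := by
  ext ⟨i, j⟩ ⟨k, l⟩
  simp [amp, sub_mul]

lemma amp_neg (A : Matrix (Fin m) (Fin m) ℂ) : amp n (-A) = -amp n A := by
  ext ⟨i, j⟩ ⟨k, l⟩
  simp [amp]

lemma amp_conjTranspose (A : Matrix (Fin m) (Fin m) ℂ) : (amp n A)ᴴ = amp n Aᴴ := by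
  simp [amp, conjTranspose_kronecker]

lemma amp_mem_unitary {U : Matrix (Fin m) (Fin m) ℂ} (hU : U ∈ unitaryGroup (Fin m) ℂ) :
    amp n U ∈ unitaryGroup (Fin m × Fin n) ℂ := by
  rw [mem_unitary_iff, amp_conjTranspose, ← amp_mul, mem_unitary_iff.1 hU, amp_one]

lemma amp_udv (U V : Matrix (Fin m) (Fin m) ℂ) (d : Fin m → ℂ) :
    amp n (udv U V d) = udv (amp n U) (amp n V) (fun q => d q.1) := by
  have : amp n (diagonal d) = diagonal (fun q : Fin m × Fin n => d q.1) := by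
    rw [amp, ← diagonal_one, diagonal_kronecker_diagonal]
    simp
  rw [udv, amp_mul, amp_mul, this, ← amp_conjTranspose, udv]

lemma norm_amp_udv_le {U V : Matrix (Fin m) (Fin m) ℂ} (hU : U ∈ unitaryGroup (Fin m) ℂ)
    (hV : V ∈ unitaryGroup (Fin m) ℂ) {d : Fin m → ℂ} {c : ℝ} (hc : 0 ≤ c)
    (hd : ∀ i, ‖d i‖ ≤ c) : ‖amp n (udv U V d)‖ ≤ c := by
  rw [amp_udv]
  exact norm_udv_le (amp_mem_unitary hU) (amp_mem_unitary hV) hc fun q => hd q.1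

lemma partialTrace₂_amp_mul (C : Matrix (Fin m) (Fin m) ℂ)
    (X : Matrix (Fin m × Fin n) (Fin m × Fin n) ℂ) :
    partialTrace₂ (amp n C * X) = C * partialTrace₂ X := by
  ext i k
  simp only [partialTrace₂, of_apply, mul_apply, amp, Fintype.sum_prod_type, kroneckerMap_apply,
    one_apply, mul_ite, mul_one, mul_zero, ite_mul, zero_mul, Finset.sum_ite_eq, Finset.mem_univ,
    if_true, Finset.mul_sum]
  rw [Finset.sum_comm]

lemma partialTrace₂_conjTranspose (X : Matrix (Fin m × Fin n) (Fin m × Fin n) ℂ) :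
    partialTrace₂ Xᴴ = (partialTrace₂ X)ᴴ := by
  ext i k
  simp [partialTrace₂, conjTranspose_apply]

lemma partialTrace₂_mul_amp (C : Matrix (Fin m) (Fin m) ℂ)
    (X : Matrix (Fin m × Fin n) (Fin m × Fin n) ℂ) :
    partialTrace₂ (X * amp n C) = partialTrace₂ X * C := by
  rw [← conjTranspose_inj, ← partialTrace₂_conjTranspose, conjTranspose_mul, conjTranspose_mul,
    amp_conjTranspose, partialTrace₂_amp_mul, partialTrace₂_conjTranspose]

lemma trace_partialTrace₂ (X : Matrix (Fin m × Fin n) (Fin m × Fin n) ℂ) :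
    (partialTrace₂ X).trace = X.trace := by
  simp [partialTrace₂, trace, Fintype.sum_prod_type]

lemma trace_amp_mul (C : Matrix (Fin m) (Fin m) ℂ)
    (X : Matrix (Fin m × Fin n) (Fin m × Fin n) ℂ) :
    (amp n C * X).trace = (C * partialTrace₂ X).trace := by
  rw [← trace_partialTrace₂, partialTrace₂_amp_mul]

lemma posSemidef_partialTrace₂ {X : Matrix (Fin m × Fin n) (Fin m × Fin n) ℂ}
    (hX : X.PosSemidef) : (partialTrace₂ X).PosSemidef := by
  have h : partialTrace₂ X = ∑ j : Fin n, X.submatrix (fun i => (i, j)) (fun i => (i, j)) := by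
    ext i k
    simp [partialTrace₂, Matrix.sum_apply]
  rw [h]
  exact posSemidef_sum _ fun j _ => hX.submatrix _

lemma posSemidef_udv {ι : Type*} [Fintype ι] [DecidableEq ι] (U : Matrix ι ι ℂ) {x : ι → ℝ}
    (hx : ∀ i, 0 ≤ x i) : (udv U U (fun i => (x i : ℂ))).PosSemidef :=
  (PosSemidef.diagonal fun i => by simpa using hx i).mul_mul_conjTranspose_same U

/-- A matrix annihilating a marginal of a positive power annihilates every power. -/
lemma amp_mul_udv_wpow_eq_zero {U : Matrix (Fin m × Fin n) (Fin m × Fin n) ℂ}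
    (hU : U ∈ unitaryGroup (Fin m × Fin n) ℂ) {x : Fin m × Fin n → ℝ}
    {C : Matrix (Fin m) (Fin m) ℂ} {r : ℝ}
    (hC : C * partialTrace₂ (udv U U (fun i => wpow (x i) r)) = 0) (z : ℂ) :
    amp n C * udv U U (fun i => wpow (x i) z) = 0 := by
  have h1 : amp n C * udv U U (fun i => wpow (x i) (r / 2 : ℝ)) = 0 := by
    apply eq_zero_of_hs_eq_zero
    have h := trace_mul_conjTranspose (amp n C * udv U U (fun i => wpow (x i) (r / 2 : ℝ)))
    have e : amp n C * udv U U (fun i => wpow (x i) (r / 2 : ℝ)) *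
        (amp n C * udv U U (fun i => wpow (x i) (r / 2 : ℝ)))ᴴ =
        amp n C * (udv U U (fun i => wpow (x i) r) * amp n Cᴴ) := by
      rw [conjTranspose_mul, conjTranspose_udv, amp_conjTranspose, Matrix.mul_assoc,
        ← Matrix.mul_assoc (udv _ _ _) (udv _ _ _), udv_mul_udv hU]
      congr 4
      ext i
      rw [Pi.mul_apply, Pi.star_apply, star_wpow, wpow_mul_wpow]
      congr 1
      simp only [Complex.star_def, Complex.conj_ofReal]
      push_cast
      ring
    rw [e, trace_amp_mul, partialTrace₂_mul_amp, ← Matrix.mul_assoc, hC, Matrix.zero_mul,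
      trace_zero] at h
    exact_mod_cast h.symm
  have h2 : udv U U (fun i => wpow (x i) z) = udv U U (fun i => wpow (x i) (r / 2 : ℝ)) *
      udv U U (fun i => wpow (x i) (z - (r / 2 : ℝ))) := by
    rw [udv_mul_udv hU]
    congr 1
    ext i
    rw [Pi.mul_apply, wpow_mul_wpow]
    congr 1
    ring
  rw [h2, ← Matrix.mul_assoc, h1, Matrix.zero_mul]

end Kron

/-! ### Analytic matrix families and the three lines theorem. -/

section StripBounded

/-- Entire functions that are bounded on the strip `0 ≤ re z ≤ 1`. -/
def StripBounded (f : ℂ → ℂ) : Prop :=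
  Differentiable ℂ f ∧ ∃ C, ∀ z : ℂ, 0 ≤ z.re → z.re ≤ 1 → ‖f z‖ ≤ C

lemma StripBounded.const (c : ℂ) : StripBounded fun _ => c :=
  ⟨differentiable_const c, ‖c‖, fun _ _ _ => le_rfl⟩

lemma StripBounded.mul {f g : ℂ → ℂ} (hf : StripBounded f) (hg : StripBounded g) :
    StripBounded fun z => f z * g z := by
  obtain ⟨hf, C, hC⟩ := hf
  obtain ⟨hg, D, hD⟩ := hg
  refine ⟨hf.mul hg, C * D, fun z h0 h1 => ?_⟩
  rw [norm_mul]
  exact mul_le_mul (hC z h0 h1) (hD z h0 h1) (norm_nonneg _) ((norm_nonneg _).trans (hC z h0 h1))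

lemma StripBounded.sum {κ : Type*} (s : Finset κ) {f : κ → ℂ → ℂ}
    (hf : ∀ i, StripBounded (f i)) : StripBounded fun z => ∑ i ∈ s, f i z := by
  choose hd C hC using hf
  refine ⟨by fun_prop, ∑ i ∈ s, C i, fun z h0 h1 => ?_⟩
  exact (norm_sum_le _ _).trans (Finset.sum_le_sum fun i _ => hC i z h0 h1)

lemma StripBounded.wpow (x a b : ℝ) : StripBounded fun z => wpow x (a * z + b) := by
  refine ⟨fun z => ?_, Real.exp ((|a| + |b|) * |Real.log x|), fun z h0 h1 => ?_⟩
  · have h : HasDerivAt (fun w : ℂ => (a : ℂ) * w + b) a z := by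
      simpa using ((hasDerivAt_id z).const_mul (a : ℂ)).add_const (b : ℂ)
    exact (HasDerivAt.comp z (hasDerivAt_wpow x (a * z + b)) h).differentiableAt
  · unfold OperatorSpaceEntropy.wpow
    split_ifs
    · simp [Real.exp_nonneg]
    · rw [Complex.norm_exp]
      refine Real.exp_le_exp.2 ?_
      simp only [Complex.mul_re, Complex.add_re, Complex.ofReal_re, Complex.ofReal_im, zero_mul,
        sub_zero, mul_zero]
      refine (le_abs_self _).trans ?_
      rw [abs_mul]
      gcongr
      refine (abs_add_le _ _).trans ?_
      rw [abs_mul]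
      gcongr
      rw [abs_of_nonneg h0]
      exact mul_le_of_le_one_right (abs_nonneg _) h1

-- The width `e` is left free because the lower bound interpolates on 0 ≤ Re z ≤ 1 - 1/p, whereas
-- boundedness is recorded on the unit strip; hence `e ≤ 1`.
open Complex.HadamardThreeLines in
lemma StripBounded.three_lines {f : ℂ → ℂ} (hf : StripBounded f) {e a b t : ℝ} (he : 0 < e)
    (he1 : e ≤ 1) (ha : ∀ z : ℂ, z.re = 0 → ‖f z‖ ≤ a) (hb : ∀ z : ℂ, z.re = e → ‖f z‖ ≤ b)
    (ht : 0 ≤ t) (hte : t ≤ e) : ‖f t‖ ≤ a ^ (1 - t / e) * b ^ (t / e) := by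
  obtain ⟨hd, C, hC⟩ := hf
  have h := norm_le_interp_of_mem_verticalClosedStrip' (f := f) (z := t) (l := 0) (u := e) he
    (by simp [verticalClosedStrip, ht, hte]) hd.diffContOnCl
    ⟨C, by rintro _ ⟨z, hz, rfl⟩; exact hC z hz.1 (hz.2.trans he1)⟩
    (fun z hz => ha z hz) (fun z hz => hb z hz)
  simpa using h

variable {ι : Type*} [Fintype ι] [DecidableEq ι]

/-- Matrix families with strip-bounded entries. -/
def MStripBounded (M : ℂ → Matrix ι ι ℂ) : Prop := ∀ i j, StripBounded fun z => M z i j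

lemma MStripBounded.const (M : Matrix ι ι ℂ) : MStripBounded fun _ => M :=
  fun i j => StripBounded.const (M i j)

lemma MStripBounded.mul {M N : ℂ → Matrix ι ι ℂ} (hM : MStripBounded M) (hN : MStripBounded N) :
    MStripBounded fun z => M z * N z := by
  intro i j
  simp only [mul_apply]
  exact StripBounded.sum _ fun k => (hM i k).mul (hN k j)

lemma MStripBounded.trace {M : ℂ → Matrix ι ι ℂ} (hM : MStripBounded M) :
    StripBounded fun z => (M z).trace := by
  simp only [Matrix.trace, diag_apply]
  exact StripBounded.sum _ fun k => hM k k

lemma MStripBounded.udv (U V : Matrix ι ι ℂ) {d : ℂ → ι → ℂ}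
    (hd : ∀ i, StripBounded fun z => d z i) : MStripBounded fun z => udv U V (d z) := by
  refine MStripBounded.mul (MStripBounded.mul (MStripBounded.const U) fun i j => ?_)
    (MStripBounded.const Vᴴ)
  by_cases h : i = j
  · subst h
    simpa using hd i
  · simpa [h] using StripBounded.const 0

lemma MStripBounded.udv_wpow (U V : Matrix ι ι ℂ) (x : ι → ℝ) (a b : ℝ) :
    MStripBounded fun z =>
      OperatorSpaceEntropy.udv U V (fun i => OperatorSpaceEntropy.wpow (x i) (a * z + b)) :=
  MStripBounded.udv U V fun i => StripBounded.wpow (x i) a b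

lemma MStripBounded.amp {m n : ℕ} {M : ℂ → Matrix (Fin m) (Fin m) ℂ} (hM : MStripBounded M) :
    MStripBounded fun z => amp n (M z) :=
  fun i j => (hM i.1 j.1).mul (StripBounded.const _)

end StripBounded

/-! ### Differentiating matrix families. -/

section Deriv

variable {ι : Type*} [Fintype ι] [DecidableEq ι]

/-- Entrywise derivative of a matrix family. -/
def MHasDerivAt (M : ℂ → Matrix ι ι ℂ) (M' : Matrix ι ι ℂ) (z : ℂ) : Prop :=
  ∀ i j, HasDerivAt (fun w => M w i j) (M' i j) z

lemma MHasDerivAt.const (M : Matrix ι ι ℂ) (z : ℂ) : MHasDerivAt (fun _ => M) 0 z :=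
  fun i j => hasDerivAt_const z (M i j)

lemma MHasDerivAt.mul {M N : ℂ → Matrix ι ι ℂ} {M' N' : Matrix ι ι ℂ} {z : ℂ}
    (hM : MHasDerivAt M M' z) (hN : MHasDerivAt N N' z) :
    MHasDerivAt (fun w => M w * N w) (M' * N z + M z * N') z := by
  intro i j
  simp only [mul_apply, Matrix.add_apply, ← Finset.sum_add_distrib]
  exact HasDerivAt.fun_sum fun k _ => HasDerivAt.fun_mul (hM i k) (hN k j)

lemma MHasDerivAt.trace {M : ℂ → Matrix ι ι ℂ} {M' : Matrix ι ι ℂ} {z : ℂ}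
    (hM : MHasDerivAt M M' z) : HasDerivAt (fun w => (M w).trace) M'.trace z := by
  simp only [Matrix.trace, diag_apply]
  exact HasDerivAt.fun_sum fun k _ => hM k k

lemma MHasDerivAt.udv (U V : Matrix ι ι ℂ) {d : ℂ → ι → ℂ} {d' : ι → ℂ} {z : ℂ}
    (hd : ∀ i, HasDerivAt (fun w => d w i) (d' i) z) :
    MHasDerivAt (fun w => udv U V (d w)) (udv U V d') z := by
  have h : MHasDerivAt (fun w => diagonal (d w)) (diagonal d') z := by
    intro i j
    by_cases h : i = j
    · subst h
      simpa using hd i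
    · simpa [h] using hasDerivAt_const z (0 : ℂ)
  have := ((MHasDerivAt.const U z).mul h).mul (MHasDerivAt.const Vᴴ z)
  simpa [OperatorSpaceEntropy.udv] using this

lemma MHasDerivAt.udv_wpow (U V : Matrix ι ι ℂ) (x : ι → ℝ) (a b z : ℂ) :
    MHasDerivAt (fun w => OperatorSpaceEntropy.udv U V (fun i => wpow (x i) (a * w + b)))
      (OperatorSpaceEntropy.udv U V
        (fun i => a * (Real.log (x i) * wpow (x i) (a * z + b)))) z := by
  refine MHasDerivAt.udv U V fun i => ?_
  have h1 : HasDerivAt (fun w : ℂ => a * w + b) a z := by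
    simpa using ((hasDerivAt_id z).const_mul a).add_const b
  have := (hasDerivAt_wpow (x i) (a * z + b)).comp z h1
  rwa [mul_comm] at this

lemma MHasDerivAt.amp {m n : ℕ} {M : ℂ → Matrix (Fin m) (Fin m) ℂ} {M' : Matrix (Fin m) (Fin m) ℂ}
    {z : ℂ} (hM : MHasDerivAt M M' z) : MHasDerivAt (fun w => amp n (M w)) (amp n M') z :=
  fun i j => (hM i.1 j.1).mul_const _

/-- Both sides equal 1 at t = 0, so the right difference quotients of their difference are
nonnegative. This extracts the infinitesimal content of a three lines estimate. -/
lemma deriv_le_of_le_exp {f : ℝ → ℝ} {f' k e : ℝ} (hf : HasDerivAt f f' 0) (h0 : f 0 = 1)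
    (he : 0 < e) (h : ∀ t, 0 < t → t < e → f t ≤ Real.exp (k * t)) : f' ≤ k := by
  have h1 : HasDerivAt (fun t => Real.exp (k * t) - f t) (k - f') 0 := by
    have := (((hasDerivAt_id' (0 : ℝ)).const_mul k).exp).fun_sub hf
    simpa using this
  have h2 := h1.tendsto_slope_zero_right
  have h3 : 0 ≤ k - f' := by
    refine ge_of_tendsto h2 ?_
    filter_upwards [Ioo_mem_nhdsGT he] with t ht
    simp only [zero_add, mul_zero, Real.exp_zero, h0, sub_self, sub_zero, smul_eq_mul]
    exact mul_nonneg (inv_nonneg.2 ht.1.le) (sub_nonneg.2 (h t ht.1 ht.2))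
  linarith

end Deriv

/-! ### The `(∞,p)` norm as a finite supremum. -/

section NormInfty

variable {m n : ℕ}

lemma apply_le_schattenNorm_udv {ι : Type*} [Fintype ι] [DecidableEq ι] {U V : Matrix ι ι ℂ}
    (hU : U ∈ unitaryGroup ι ℂ) (hV : V ∈ unitaryGroup ι ℂ) (d : ι → ℂ) {p : ℝ} (hp : 0 < p)
    (i : ι) : ‖d i‖ ≤ schattenNorm p (udv U V d) := by
  rw [schattenNorm_udv hU hV]
  calc ‖d i‖ = (‖d i‖ ^ p) ^ (1 / p) := by
        rw [← Real.rpow_mul (norm_nonneg _), mul_one_div_cancel hp.ne', Real.rpow_one]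
    _ ≤ _ := by
        refine Real.rpow_le_rpow (by positivity) ?_ (by positivity)
        exact Finset.single_le_sum (f := fun i => ‖d i‖ ^ p) (fun _ _ => by positivity)
          (Finset.mem_univ i)

lemma norm_amp_le_schattenNorm (A : Matrix (Fin m) (Fin m) ℂ) {p : ℝ} (hp : 0 < p) :
    ‖amp n A‖ ≤ schattenNorm p A := by
  obtain ⟨U, hU, V, hV, s, -, rfl⟩ := exists_svd A
  exact norm_amp_udv_le hU hV (schattenNorm_nonneg _ _)
    fun i => apply_le_schattenNorm_udv hU hV (fun i => (s i : ℂ)) hp i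

lemma schattenNorm_le_norm {ι : Type*} [Fintype ι] [DecidableEq ι] (Y : Matrix ι ι ℂ) {p : ℝ}
    (hp : 0 < p) : schattenNorm p Y ≤ (Fintype.card ι : ℝ) ^ (1 / p) * ‖Y‖ := by
  obtain ⟨U, hU, V, hV, s, hs, h⟩ := exists_svd Y
  have hle : ∀ i, ‖(s i : ℂ)‖ ≤ ‖Y‖ := by
    intro i
    have e : Uᴴ * Y * V = diagonal (fun i => (s i : ℂ)) := by
      rw [h, udv]
      calc Uᴴ * (U * diagonal (fun i => (s i : ℂ)) * Vᴴ) * V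
          = (Uᴴ * U) * diagonal (fun i => (s i : ℂ)) * (Vᴴ * V) := by
            simp only [Matrix.mul_assoc]
        _ = _ := by
            rw [mem_unitary_iff.1 hU, mem_unitary_iff.1 hV, Matrix.one_mul, Matrix.mul_one]
    have e2 : (s i : ℂ) = (Uᴴ * Y * V) i i := by rw [e, diagonal_apply_eq]
    rw [e2]
    calc ‖(Uᴴ * Y * V) i i‖ ≤ ‖Uᴴ * Y * V‖ := norm_apply_le _ _ _
      _ ≤ ‖Uᴴ‖ * ‖Y‖ * ‖V‖ := by
          refine (norm_mul_le _ _).trans ?_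
          gcongr
          exact norm_mul_le _ _
      _ ≤ 1 * ‖Y‖ * 1 := by
          gcongr
          · exact norm_conjTranspose_unitary_le hU
          · exact norm_unitary_le hV
      _ = ‖Y‖ := by ring
  have hY := norm_nonneg Y
  rw [h, schattenNorm_udv hU hV, ← h]
  calc (∑ i, ‖(s i : ℂ)‖ ^ p) ^ (1 / p) ≤ (∑ _i : ι, ‖Y‖ ^ p) ^ (1 / p) := by
        gcongr with i
        exact hle i
    _ = (Fintype.card ι : ℝ) ^ (1 / p) * ‖Y‖ := by
        rw [Finset.sum_const, nsmul_eq_mul, Finset.card_univ,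
          Real.mul_rpow (by positivity) (by positivity), ← Real.rpow_mul hY,
          mul_one_div_cancel hp.ne', Real.rpow_one]

/-- Only finiteness of the constant matters: it bounds the set of quotients defining `normInfty`, so
that its `sSup` is a genuine supremum rather than the default value 0. -/
lemma schattenNorm_amp_mul_mul_amp_le (Z : Matrix (Fin m × Fin n) (Fin m × Fin n) ℂ) {p : ℝ}
    (hp : 0 < p) : ∃ C, 0 ≤ C ∧ ∀ A B : Matrix (Fin m) (Fin m) ℂ,
      schattenNorm p (amp n A * Z * amp n B) ≤
        C * (schattenNorm (2 * p) A * schattenNorm (2 * p) B) := by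
  refine ⟨(Fintype.card (Fin m × Fin n) : ℝ) ^ (1 / p) * ‖Z‖, by positivity, fun A B => ?_⟩
  refine (schattenNorm_le_norm _ hp).trans ?_
  have hA := norm_amp_le_schattenNorm (n := n) A (by linarith : 0 < 2 * p)
  have hB := norm_amp_le_schattenNorm (n := n) B (by linarith : 0 < 2 * p)
  rw [mul_assoc ((Fintype.card (Fin m × Fin n) : ℝ) ^ (1 / p))]
  refine mul_le_mul_of_nonneg_left ?_ (by positivity)
  calc ‖amp n A * Z * amp n B‖ ≤ ‖amp n A‖ * ‖Z‖ * ‖amp n B‖ := by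
        refine (norm_mul_le _ _).trans ?_
        gcongr
        exact norm_mul_le _ _
    _ ≤ schattenNorm (2 * p) A * ‖Z‖ * schattenNorm (2 * p) B := by
        have := schattenNorm_nonneg (2 * p) A
        gcongr
    _ = _ := by ring

lemma schattenNorm_le_normInfty_mul (Z : Matrix (Fin m × Fin n) (Fin m × Fin n) ℂ) {p : ℝ}
    (hp : 0 < p) (A B : Matrix (Fin m) (Fin m) ℂ) :
    schattenNorm p (amp n A * Z * amp n B) ≤
      normInfty p Z * (schattenNorm (2 * p) A * schattenNorm (2 * p) B) := by
  obtain ⟨C, hC0, hC⟩ := schattenNorm_amp_mul_mul_amp_le Z hp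
  have hA := schattenNorm_nonneg (2 * p) A
  have hB := schattenNorm_nonneg (2 * p) B
  rcases (mul_nonneg hA hB).eq_or_lt with h | h
  · have := hC A B
    rw [← h] at this ⊢
    simpa using this
  · rw [← div_le_iff₀ h]
    refine le_csSup ⟨C, ?_⟩ ⟨A, B, ?_, ?_, rfl⟩
    · rintro _ ⟨A', B', -, -, rfl⟩
      exact div_le_of_le_mul₀ (mul_nonneg (schattenNorm_nonneg _ _) (schattenNorm_nonneg _ _))
        hC0 (hC A' B')
    · rintro rfl
      rw [schattenNorm_zero (by linarith)] at h
      simp at h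
    · rintro rfl
      rw [schattenNorm_zero (by linarith)] at h
      simp at h

lemma normInfty_nonneg (p : ℝ) (Z : Matrix (Fin m × Fin n) (Fin m × Fin n) ℂ) :
    0 ≤ normInfty p Z := by
  refine Real.sSup_nonneg ?_
  rintro _ ⟨A, B, -, -, rfl⟩
  exact div_nonneg (schattenNorm_nonneg _ _)
    (mul_nonneg (schattenNorm_nonneg _ _) (schattenNorm_nonneg _ _))

end NormInfty

/-! ### The lower bound. -/

section Lower

variable {m n : ℕ}

lemma sum_eq_one_of_trace_udv {ι : Type*} [Fintype ι] [DecidableEq ι] {U : Matrix ι ι ℂ}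
    (hU : U ∈ unitaryGroup ι ℂ) {x : ι → ℝ} (h : (udv U U (fun i => (x i : ℂ))).trace = 1) :
    ∑ i, x i = 1 := by
  rw [trace_udv_self hU] at h
  exact_mod_cast h

/-- Every factor in a factorization of a state satisfies Klein's inequality against the
marginal. -/
lemma trace_log_factor_le {X : Matrix (Fin m × Fin n) (Fin m × Fin n) ℂ} (hX : X.PosSemidef)
    (htr : X.trace = 1) {U V : Matrix (Fin m) (Fin m) ℂ} (hU : U ∈ unitaryGroup (Fin m) ℂ)
    {a : Fin m → ℝ} (ha : ∀ i, 0 ≤ a i)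
    {Y : Matrix (Fin m × Fin n) (Fin m × Fin n) ℂ}
    (h : X = amp n (udv U V (fun i => (a i : ℂ))) * Y) :
    (amp n (udv U U (fun i => (Real.log (a i) : ℂ))) * X).trace.re ≤
      -(1 / 2) * vnEntropy (partialTrace₂ X) + 1 / 2 * Real.log (∑ i, a i ^ 2) := by
  obtain ⟨W, hW, x, hx, h1⟩ := exists_udv_of_posSemidef (posSemidef_partialTrace₂ hX)
  have hx1 : ∑ i, x i = 1 :=
    sum_eq_one_of_trace_udv hW (by rw [← h1, trace_partialTrace₂, htr])
  rw [trace_amp_mul, h1, vnEntropy_udv hW]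
  -- The support condition holds because the marginal is the factor times another marginal: rows of
  -- `Uᴴ` with `a i = 0` annihilate it.
  refine (trace_log_mul_le hU hW ha hx hx1 fun i hi j => ?_).trans (by linarith)
  rw [← h1, h, partialTrace₂_amp_mul, udv]
  have e : Uᴴ * (U * diagonal (fun i => (a i : ℂ)) * Vᴴ * partialTrace₂ Y) =
      diagonal (fun i => (a i : ℂ)) * (Vᴴ * partialTrace₂ Y) := by
    calc _ = (Uᴴ * U) * diagonal (fun i => (a i : ℂ)) * (Vᴴ * partialTrace₂ Y) := by
          simp only [Matrix.mul_assoc]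
      _ = _ := by rw [mem_unitary_iff.1 hU, Matrix.one_mul]
  rw [e, diagonal_mul, hi]
  simp

/-- The factorization enters through an analytic family equal to 1 at z = 0: the three lines bound
is differentiated at that point and Klein's inequality is applied to each outer factor. -/
lemma exp_le_of_factorization {X : Matrix (Fin m × Fin n) (Fin m × Fin n) ℂ} (hX : X.PosSemidef)
    (htr : X.trace = 1) {p : ℝ} (hp : 1 ≤ p) (A B : Matrix (Fin m) (Fin m) ℂ)
    (Z : Matrix (Fin m × Fin n) (Fin m × Fin n) ℂ) (h : X = amp n A * Z * amp n B) :
    Real.exp ((1 - 1 / p) * (-vnEntropy X + vnEntropy (partialTrace₂ X))) ≤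
      schattenNorm (2 * 1) A * schattenNorm (2 * 1) B * normInfty p Z := by
  have hp0 : 0 < p := by linarith
  obtain ⟨Ua, hUa, Va, hVa, a, ha, rfl⟩ := exists_svd A
  obtain ⟨Ub, hUb, Vb, hVb, b, hb, rfl⟩ := exists_svd B
  obtain ⟨Ux, hUx, x, hx, hXx⟩ := exists_udv_of_posSemidef hX
  have hx1 : ∑ i, x i = 1 := sum_eq_one_of_trace_udv hUx (by rw [← hXx, htr])
  set c := normInfty p Z
  have hc : 0 ≤ c := normInfty_nonneg p Z
  set Ap : ℂ → Matrix (Fin m) (Fin m) ℂ :=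
    fun z => udv Ua Va (fun i => wpow (a i) (((-1 : ℝ) : ℂ) * z + (1 : ℝ))) with hAp
  set Bp : ℂ → Matrix (Fin m) (Fin m) ℂ :=
    fun z => udv Ub Vb (fun i => wpow (b i) (((-1 : ℝ) : ℂ) * z + (1 : ℝ))) with hBp
  set Xp : ℂ → Matrix (Fin m × Fin n) (Fin m × Fin n) ℂ :=
    fun z => udv Ux Ux (fun i => wpow (x i) (((1 : ℝ) : ℂ) * z + (0 : ℝ))) with hXp
  set F : ℂ → ℂ := fun z => (amp n (Ap z) * Z * amp n (Bp z) * Xp z).trace with hF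
  set α := ∑ i, a i ^ 2 with hα
  set β := ∑ i, b i ^ 2 with hβ
  have hFs : StripBounded F :=
    ((((MStripBounded.udv_wpow Ua Va a (-1) 1).amp.mul (MStripBounded.const Z)).mul
      (MStripBounded.udv_wpow Ub Vb b (-1) 1).amp).mul
      (MStripBounded.udv_wpow Ux Ux x 1 0)).trace
  have hA0 : Ap 0 = udv Ua Va (fun i => (a i : ℂ)) := by simp [hAp, wpow_one, ha]
  have hB0 : Bp 0 = udv Ub Vb (fun i => (b i : ℂ)) := by simp [hBp, wpow_one, hb]
  have hXX0 : X * Xp 0 = X := by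
    rw [hXx, hXp, udv_mul_udv hUx]
    congr 1
    ext i
    rw [Pi.mul_apply]
    simp only [mul_zero, zero_add, Complex.ofReal_zero]
    rw [← wpow_one (hx i), wpow_mul_wpow, add_zero]
  have hF0 : F 0 = 1 := by
    simp only [hF]
    rw [hA0, hB0, ← h, hXX0, htr]
  -- On the imaginary axis each power of a factor is that factor times a contraction, so `F z` is
  -- the trace of a contraction against `X`, whose trace norm is 1.
  have hLeft : ∀ z : ℂ, z.re = 0 → ‖F z‖ ≤ 1 := by
    intro z hz
    have eA : Ap z = udv Ua Ua (fun i => wpow (a i) (-z)) * udv Ua Va (fun i => (a i : ℂ)) := by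
      rw [udv_mul_udv hUa]
      simp only [hAp]
      congr 1
      ext i
      rw [Pi.mul_apply, ← wpow_one (ha i), wpow_mul_wpow]
      simp
    have eB : Bp z = udv Ub Vb (fun i => (b i : ℂ)) * udv Vb Vb (fun i => wpow (b i) (-z)) := by
      rw [udv_mul_udv hVb]
      simp only [hBp]
      congr 1
      ext i
      rw [Pi.mul_apply, ← wpow_one (hb i), wpow_mul_wpow]
      simp [add_comm]
    have e : F z = ((amp n (udv Vb Vb (fun i => wpow (b i) (-z))) * Xp z *
        amp n (udv Ua Ua (fun i => wpow (a i) (-z)))) * udv Ux Ux (fun i => (x i : ℂ))).trace := by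
      rw [← hXx, h]
      simp only [hF, eA, eB, amp_mul]
      rw [Matrix.mul_assoc _ (amp n (udv Ua Ua _)) _, trace_mul_comm _ (amp n (udv Ua Ua _) * _)]
      rw [← trace_mul_comm]
      simp only [Matrix.mul_assoc]
      rw [trace_mul_comm]
      simp only [Matrix.mul_assoc]
    rw [e]
    have hz' : (-z).re = 0 := by simp [hz]
    refine (norm_trace_mul_udv_le hUx hUx ?_ _).trans ?_
    · refine norm_mul_le_one (norm_mul_le_one ?_ ?_) ?_
      · exact norm_amp_udv_le hVb hVb zero_le_one fun i => norm_wpow_le_one (hb i) hz'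
      · exact norm_udv_le hUx hUx zero_le_one fun i => norm_wpow_le_one (hx i) (by simp [hz])
      · exact norm_amp_udv_le hUa hUa zero_le_one fun i => norm_wpow_le_one (ha i) hz'
    · rw [← hx1]
      refine Finset.sum_le_sum fun i _ => ?_
      simp [abs_of_nonneg (hx i)]
  have hnorm : ∀ (U V : Matrix (Fin m) (Fin m) ℂ) (_ : U ∈ unitaryGroup (Fin m) ℂ)
      (_ : V ∈ unitaryGroup (Fin m) ℂ) (s : Fin m → ℝ) (_ : ∀ i, 0 ≤ s i) (z : ℂ)
      (_ : z.re = 1 - 1 / p),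
      schattenNorm (2 * p) (udv U V (fun i => wpow (s i) (((-1 : ℝ) : ℂ) * z + (1 : ℝ)))) =
        (∑ i, s i ^ 2) ^ (1 / (2 * p)) := by
    intro U V hU hV s hs z hz
    rw [schattenNorm_udv hU hV]
    congr 1
    refine Finset.sum_congr rfl fun i _ => ?_
    have hre : (((-1 : ℝ) : ℂ) * z + (1 : ℝ)).re = 1 / p := by simp [hz]
    rw [norm_wpow' (hs i) (by rw [hre]; positivity), hre, ← Real.rpow_mul (hs i),
      ← Real.rpow_two]
    congr 1
    field_simp
  set b' := c * (α ^ (1 / (2 * p)) * β ^ (1 / (2 * p))) with hb'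
  have hα0 : 0 ≤ α := Finset.sum_nonneg fun _ _ => by positivity
  have hβ0 : 0 ≤ β := Finset.sum_nonneg fun _ _ => by positivity
  have hb0 : 0 ≤ b' := by positivity
  -- Here X^z has conjugate-exponent norm at most 1, and |a^(1-z)|^(2p) = a², so the 2p-norms of the
  -- powers are fixed powers of `α` and `β`.
  have hRight : ∀ z : ℂ, z.re = 1 - 1 / p → ‖F z‖ ≤ b' := by
    intro z hz
    refine (norm_trace_mul_udv_le_schattenNorm (amp n (Ap z) * Z * amp n (Bp z)) hUx hx hx1.le hp
      (z := ((1 : ℝ) : ℂ) * z + (0 : ℝ)) (by simp [hz])).trans ?_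
    refine (schattenNorm_le_normInfty_mul Z hp0 (Ap z) (Bp z)).trans ?_
    rw [hb', hα, hβ, ← hnorm Ua Va hUa hVa a ha z hz, ← hnorm Ub Vb hUb hVb b hb z hz]
  have hsA : schattenNorm (2 * 1) (udv Ua Va (fun i => (a i : ℂ))) = α ^ (1 / 2 : ℝ) := by
    rw [schattenNorm_udv hUa hVa]
    simp [hα]
  have hsB : schattenNorm (2 * 1) (udv Ub Vb (fun i => (b i : ℂ))) = β ^ (1 / 2 : ℝ) := by
    rw [schattenNorm_udv hUb hVb]
    simp [hβ]
  rw [hsA, hsB]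
  set L := -vnEntropy X + vnEntropy (partialTrace₂ X) with hL
  have hαpos : 0 < α := by
    refine lt_of_le_of_ne hα0 fun h0 => ?_
    rw [hα, eq_comm, Finset.sum_eq_zero_iff_of_nonneg fun _ _ => by positivity] at h0
    have : ∀ i, a i = 0 := fun i => by simpa using h0 i (Finset.mem_univ _)
    rw [h, amp_udv] at htr
    simp [this, udv, Matrix.diagonal_zero] at htr
  have hβpos : 0 < β := by
    refine lt_of_le_of_ne hβ0 fun h0 => ?_
    rw [hβ, eq_comm, Finset.sum_eq_zero_iff_of_nonneg fun _ _ => by positivity] at h0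
    have : ∀ i, b i = 0 := fun i => by simpa using h0 i (Finset.mem_univ _)
    rw [h, amp_udv Ub] at htr
    simp [this, udv, Matrix.diagonal_zero] at htr
  -- For p = 1 the strip has zero width, and the right-hand bound at z = 0 is already the claim.
  rcases hp.eq_or_lt with rfl | hp1
  · have h1 := hRight 0 (by simp)
    rw [hF0, hb'] at h1
    simp only [div_one, sub_self, zero_mul, Real.exp_zero]
    simpa [mul_comm, mul_left_comm] using h1
  have he : 0 < 1 - 1 / p := by
    rw [sub_pos, div_lt_one hp0]
    exact hp1
  have he1 : 1 - 1 / p ≤ 1 := by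
    have : 0 < 1 / p := by positivity
    linarith
  set e := 1 - 1 / p with hedef
  have hAd : MHasDerivAt Ap (-(udv Ua Ua (fun i => (Real.log (a i) : ℂ)) * Ap 0)) 0 := by
    have := MHasDerivAt.udv_wpow Ua Va a ((-1 : ℝ) : ℂ) ((1 : ℝ) : ℂ) 0
    convert this using 1
    rw [hAp, udv_mul_udv hUa, ← udv_neg]
    congr 1
    ext i
    simp
  have hBd : MHasDerivAt Bp (-(Bp 0 * udv Vb Vb (fun i => (Real.log (b i) : ℂ)))) 0 := by
    have := MHasDerivAt.udv_wpow Ub Vb b ((-1 : ℝ) : ℂ) ((1 : ℝ) : ℂ) 0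
    convert this using 1
    rw [hBp, udv_mul_udv hVb, ← udv_neg]
    congr 1
    ext i
    simp [mul_comm]
  have hXd : MHasDerivAt Xp (udv Ux Ux (fun i => (Real.log (x i) : ℂ)) * Xp 0) 0 := by
    have := MHasDerivAt.udv_wpow Ux Ux x ((1 : ℝ) : ℂ) ((0 : ℝ) : ℂ) 0
    convert this using 1
    rw [hXp, udv_mul_udv hUx]
    simp [udv]
    rfl
  have hFd := (((hAd.amp.mul (MHasDerivAt.const Z 0)).mul hBd.amp).mul hXd).trace
  have hlogA := trace_log_factor_le (Y := Z * amp n (udv Ub Vb (fun i => (b i : ℂ)))) hX htr hUa ha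
    (by rw [h, Matrix.mul_assoc])
  -- Since `X` is Hermitian, taking adjoints puts the right factor on the left; its relevant unitary
  -- becomes `Vb`.
  have hlogB := trace_log_factor_le (U := Vb) (V := Ub) (a := b)
    (Y := Zᴴ * (amp n (udv Ua Va (fun i => (a i : ℂ))))ᴴ) hX htr hVb hb (by
      conv_lhs => rw [← hX.1.eq, h]
      rw [conjTranspose_mul, conjTranspose_mul, amp_conjTranspose _, conjTranspose_udv]
      congr 3
      ext i
      simp)
  set D := (((amp n (-(udv Ua Ua (fun i => (Real.log (a i) : ℂ)) * Ap 0)) * Z + amp n (Ap 0) * 0) *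
    amp n (Bp 0) + amp n (Ap 0) * Z *
      amp n (-(Bp 0 * udv Vb Vb (fun i => (Real.log (b i) : ℂ))))) * Xp 0 +
    amp n (Ap 0) * Z * amp n (Bp 0) * (udv Ux Ux (fun i => (Real.log (x i) : ℂ)) * Xp 0)).trace
    with hD
  have hX0 : amp n (Ap 0) * Z * amp n (Bp 0) = X := by rw [hA0, hB0, ← h]
  have hX0X : Xp 0 * X = X := by
    rw [hXx, hXp, udv_mul_udv hUx]
    congr 1
    ext i
    rw [Pi.mul_apply]
    simp only [mul_zero, zero_add, Complex.ofReal_zero]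
    rw [← wpow_one (hx i), wpow_mul_wpow, zero_add]
  have hDval : D = -(amp n (udv Ua Ua (fun i => (Real.log (a i) : ℂ))) * X).trace -
      (amp n (udv Vb Vb (fun i => (Real.log (b i) : ℂ))) * X).trace +
      ((∑ i, x i * Real.log (x i) : ℝ) : ℂ) := by
    have e1 : (amp n (-(udv Ua Ua (fun i => (Real.log (a i) : ℂ)) * Ap 0)) * Z * amp n (Bp 0) *
        Xp 0).trace = -(amp n (udv Ua Ua (fun i => (Real.log (a i) : ℂ))) * X).trace := by
      have : amp n (-(udv Ua Ua (fun i => (Real.log (a i) : ℂ)) * Ap 0)) * Z * amp n (Bp 0) *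
          Xp 0 = -(amp n (udv Ua Ua (fun i => (Real.log (a i) : ℂ))) *
            (amp n (Ap 0) * Z * amp n (Bp 0) * Xp 0)) := by
        rw [amp_neg, amp_mul]
        simp only [Matrix.neg_mul, Matrix.mul_assoc]
      rw [this, hX0, hXX0, trace_neg]
    have e2 : (amp n (Ap 0) * Z * amp n (-(Bp 0 * udv Vb Vb (fun i => (Real.log (b i) : ℂ)))) *
        Xp 0).trace = -(amp n (udv Vb Vb (fun i => (Real.log (b i) : ℂ))) * X).trace := by
      have : amp n (Ap 0) * Z * amp n (-(Bp 0 * udv Vb Vb (fun i => (Real.log (b i) : ℂ)))) *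
          Xp 0 = -(amp n (Ap 0) * Z * amp n (Bp 0) *
            (amp n (udv Vb Vb (fun i => (Real.log (b i) : ℂ))) * Xp 0)) := by
        rw [amp_neg, amp_mul]
        simp only [Matrix.neg_mul, Matrix.mul_neg, Matrix.mul_assoc]
      rw [this, hX0, trace_neg, trace_mul_comm, Matrix.mul_assoc, hX0X]
    have e3 : (amp n (Ap 0) * Z * amp n (Bp 0) *
        (udv Ux Ux (fun i => (Real.log (x i) : ℂ)) * Xp 0)).trace =
        ((∑ i, x i * Real.log (x i) : ℝ) : ℂ) := by
      rw [hX0, trace_mul_comm, Matrix.mul_assoc, hX0X, hXx, udv_mul_udv hUx, trace_udv_self hUx]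
      push_cast
      exact Finset.sum_congr rfl fun i _ => mul_comm _ _
    rw [hD, Matrix.mul_zero, add_zero, Matrix.add_mul, trace_add, trace_add, e1, e2, e3]
    ring
  have hDre : L - 1 / 2 * Real.log α - 1 / 2 * Real.log β ≤ D.re := by
    have hSX : ∑ i, x i * Real.log (x i) = -vnEntropy X := by rw [hXx, vnEntropy_udv hUx, neg_neg]
    rw [hDval, Complex.add_re, Complex.sub_re, Complex.neg_re, Complex.ofReal_re, hSX]
    linarith
  have hder : HasDerivAt (fun t : ℝ => (F t).re) D.re 0 :=
    HasDerivAt.real_of_complex (e := F) (z := 0) (by simpa using hFd)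
  have hF0' : (F (0 : ℝ)).re = 1 := by simp [hF0]
  have hle : ∀ t, 0 < t → t < e → (F t).re ≤ b' ^ (t / e) := by
    intro t ht hte
    have := hFs.three_lines he he1 hLeft hRight ht.le hte.le
    rw [Real.one_rpow, one_mul] at this
    exact (Complex.re_le_norm _).trans this
  -- If b' = 0, then Re F ≤ 0 on (0, e), so the derivative would be at most any `k`; taking `D.re -
  -- 1` is contradictory.
  rcases hb0.eq_or_lt with hb0 | hbpos
  · have := deriv_le_of_le_exp (k := D.re - 1) hder hF0' he fun t ht hte => by
      refine (hle t ht hte).trans ?_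
      rw [← hb0, Real.zero_rpow (div_pos ht he).ne']
      exact Real.exp_nonneg _
    linarith
  have key := deriv_le_of_le_exp (k := Real.log b' / e) hder hF0' he fun t ht hte => by
    refine (hle t ht hte).trans_eq ?_
    rw [Real.rpow_def_of_pos hbpos]
    congr 1
    ring
  rw [le_div_iff₀ he] at key
  have hcpos : 0 < c := by
    refine lt_of_le_of_ne hc fun h0 => ?_
    rw [hb', ← h0, zero_mul] at hbpos
    exact lt_irrefl _ hbpos
  have hlogb : Real.log b' = Real.log c + 1 / (2 * p) * (Real.log α + Real.log β) := by
    rw [hb', Real.log_mul hcpos.ne' (by positivity), Real.log_mul (by positivity) (by positivity),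
      Real.log_rpow hαpos, Real.log_rpow hβpos]
    ring
  -- With 1/(2p) = (1 - e)/2, the terms in e log α and e log β from Klein and from `b'` cancel,
  -- leaving the square roots of `α` and `β`.
  have hfin : e * L ≤ Real.log (α ^ (1 / 2 : ℝ) * β ^ (1 / 2 : ℝ) * c) := by
    rw [Real.log_mul (by positivity) hcpos.ne', Real.log_mul (by positivity) (by positivity),
      Real.log_rpow hαpos, Real.log_rpow hβpos]
    have h1 := mul_le_mul_of_nonneg_right hDre he.le
    have h2 : 1 / (2 * p) = 1 / 2 * (1 - e) := by rw [hedef]; field_simp; ring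
    rw [hlogb, h2] at key
    linarith
  rw [← Real.le_log_iff_exp_le (by positivity)]
  exact hfin

end Lower

/-! ### The upper bound through an explicit factorization. -/

section Upper

variable {m n : ℕ}

lemma udv_wpow_mul {ι : Type*} [Fintype ι] [DecidableEq ι] {V : Matrix ι ι ℂ}
    (hV : V ∈ unitaryGroup ι ℂ) (U W : Matrix ι ι ℂ) (x : ι → ℝ) (z w : ℂ) :
    udv U V (fun i => wpow (x i) z) * udv V W (fun i => wpow (x i) w) =
      udv U W (fun i => wpow (x i) (z + w)) := by
  rw [udv_mul_udv hV]
  congr 1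
  ext i
  rw [Pi.mul_apply, wpow_mul_wpow]

lemma conjTranspose_udv_wpow {ι : Type*} [Fintype ι] [DecidableEq ι] (U V : Matrix ι ι ℂ)
    (x : ι → ℝ) (z : ℂ) :
    (udv U V (fun i => wpow (x i) z))ᴴ = udv V U (fun i => wpow (x i) (star z)) := by
  rw [conjTranspose_udv]
  congr 1
  ext i
  rw [Pi.star_apply, star_wpow]

lemma udv_wpow_one {ι : Type*} [Fintype ι] [DecidableEq ι] (U V : Matrix ι ι ℂ) {x : ι → ℝ}
    (hx : ∀ i, 0 ≤ x i) : udv U V (fun i => wpow (x i) 1) = udv U V (fun i => (x i : ℂ)) := by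
  congr 1
  ext i
  rw [wpow_one (hx i)]

variable {U : Matrix (Fin m × Fin n) (Fin m × Fin n) ℂ} {x : Fin m × Fin n → ℝ}
  {V : Matrix (Fin m) (Fin m) ℂ} {y : Fin m → ℝ} {p : ℝ}

/-- On Re z = 1 the product of X^(pz/2) with its adjoint is X^p, whose marginal P = V diag(y) V* can
be absorbed: P^(-z/2) P^(1/2) has purely imaginary exponent and is a contraction. What remains is
the Hilbert–Schmidt norm of A^(pz). -/
lemma hs_amp_mul_le (hU : U ∈ unitaryGroup (Fin m × Fin n) ℂ)
    (hV : V ∈ unitaryGroup (Fin m) ℂ) (hy : ∀ i, 0 ≤ y i) (hp : 0 < p)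
    (hP : partialTrace₂ (udv U U (fun i => wpow (x i) p)) = udv V V (fun i => (y i : ℂ)))
    {S T : Matrix (Fin m) (Fin m) ℂ} (hS : S ∈ unitaryGroup (Fin m) ℂ)
    (hT : T ∈ unitaryGroup (Fin m) ℂ) {a : Fin m → ℝ} (ha : ∀ i, 0 ≤ a i) {z : ℂ}
    (hz : z.re = 1) :
    hs (amp n (udv S T (fun i => wpow (a i) (p * z))) *
      amp n (udv V V (fun i => wpow (y i) (-z / 2))) *
      udv U U (fun i => wpow (x i) (p * z / 2))) ≤ ∑ i, a i ^ (2 * p) := by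
  set A := udv S T (fun i => wpow (a i) (p * z))
  set R := udv V V (fun i => wpow (y i) (-z / 2))
  have hsum : (p : ℂ) * z / 2 + star ((p : ℂ) * z / 2) = p := by
    rw [Complex.star_def, Complex.add_conj]
    simp [hz]
    ring
  have hXX : udv U U (fun i => wpow (x i) (p * z / 2)) *
      (udv U U (fun i => wpow (x i) (p * z / 2)))ᴴ = udv U U (fun i => wpow (x i) p) := by
    rw [conjTranspose_udv_wpow, udv_wpow_mul hU, hsum]
  have hPs : udv V V (fun i => (y i : ℂ)) = udv V V (fun i => wpow (y i) (1 / 2)) *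
      (udv V V (fun i => wpow (y i) (1 / 2)))ᴴ := by
    rw [conjTranspose_udv_wpow, udv_wpow_mul hV, ← udv_wpow_one V V hy]
    congr 2
    ext i
    congr 1
    simp [Complex.ext_iff]
    norm_num
  have h1 : (hs (amp n A * amp n R * udv U U (fun i => wpow (x i) (p * z / 2))) : ℂ) =
      hs (A * (R * udv V V (fun i => wpow (y i) (1 / 2)))) := by
    rw [← trace_mul_conjTranspose, ← trace_mul_conjTranspose, ← amp_mul]
    calc _ = (amp n (A * R) * (udv U U (fun i => wpow (x i) p) * amp n (A * R)ᴴ)).trace := by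
          rw [← hXX, conjTranspose_mul, amp_conjTranspose]
          simp only [Matrix.mul_assoc]
      _ = (A * R * (udv V V (fun i => (y i : ℂ)) * (A * R)ᴴ)).trace := by
          rw [trace_amp_mul, partialTrace₂_mul_amp, hP]
      _ = _ := by
          rw [hPs]
          simp only [conjTranspose_mul, Matrix.mul_assoc]
  have h2 : hs (amp n A * amp n R * udv U U (fun i => wpow (x i) (p * z / 2))) =
      hs (A * (R * udv V V (fun i => wpow (y i) (1 / 2)))) := by exact_mod_cast h1
  rw [h2]
  refine (hs_mul_le' A ?_).trans ?_
  · rw [udv_wpow_mul hV]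
    refine norm_udv_le hV hV zero_le_one fun i => norm_wpow_le_one (hy i) ?_
    simp [hz]
    norm_num
  · rw [hs_udv hS hT]
    refine Finset.sum_le_sum fun i _ => ?_
    have hre : ((p : ℂ) * z).re = p := by simp [hz]
    rw [norm_wpow' (ha i) (by rw [hre]; exact hp.ne'), hre, ← Real.rpow_two,
      ← Real.rpow_mul (ha i), mul_comm p 2]

/-- Interpolation against the dual element `Q` of the product `Y`. At z = 1/p the function is N =
‖Y‖_p^p. On Re z = 0 all other factors are contractions and `Q` has trace norm at most `N`; on Re z
= 1 the bound is √α √β. Cancelling N^(1-1/p) gives the claim. -/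
lemma schattenNorm_amp_mul_le (hU : U ∈ unitaryGroup (Fin m × Fin n) ℂ)
    (hx : ∀ i, 0 ≤ x i) (hV : V ∈ unitaryGroup (Fin m) ℂ) (hy : ∀ i, 0 ≤ y i) (hp : 1 ≤ p)
    (hP : partialTrace₂ (udv U U (fun i => wpow (x i) p)) = udv V V (fun i => (y i : ℂ)))
    (A B : Matrix (Fin m) (Fin m) ℂ) :
    schattenNorm p (amp n A * (amp n (udv V V (fun i => wpow (y i) (-(1 / p) / 2))) *
      udv U U (fun i => (x i : ℂ)) * amp n (udv V V (fun i => wpow (y i) (-(1 / p) / 2)))) *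
      amp n B) ≤ schattenNorm (2 * p) A * schattenNorm (2 * p) B := by
  have hp0 : 0 < p := by linarith
  have hpC : (p : ℂ) ≠ 0 := by exact_mod_cast hp0.ne'
  obtain ⟨Ua, hUa, Va, hVa, a, ha, rfl⟩ := exists_svd A
  obtain ⟨Ub, hUb, Vb, hVb, b, hb, rfl⟩ := exists_svd B
  set Y := amp n (udv Ua Va (fun i => (a i : ℂ))) *
    (amp n (udv V V (fun i => wpow (y i) (-(1 / p) / 2))) *
      udv U U (fun i => (x i : ℂ)) * amp n (udv V V (fun i => wpow (y i) (-(1 / p) / 2)))) *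
      amp n (udv Ub Vb (fun i => (b i : ℂ))) with hYdef
  obtain ⟨S, hS, T, hT, s, hs0, hY⟩ := exists_svd Y
  set Q : ℂ → Matrix (Fin m × Fin n) (Fin m × Fin n) ℂ :=
    fun z => udv T S (fun i => wpow (s i) (p * (1 - z))) with hQ
  set F : ℂ → ℂ := fun z => (amp n (udv Ua Va (fun i => wpow (a i) (p * z))) *
    (amp n (udv V V (fun i => wpow (y i) (-z / 2))) * udv U U (fun i => wpow (x i) (p * z)) *
      amp n (udv V V (fun i => wpow (y i) (-z / 2)))) *
    amp n (udv Ub Vb (fun i => wpow (b i) (p * z))) * Q z).trace with hF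
  have hFs : StripBounded F := by
    have e1 : ∀ {ι : Type} [Fintype ι] [DecidableEq ι] (U V : Matrix ι ι ℂ) (x : ι → ℝ),
        MStripBounded fun z => udv U V (fun i => wpow (x i) (p * z)) := fun U V x => by
      simpa using MStripBounded.udv_wpow U V x p 0
    have e2 : MStripBounded fun z => udv V V (fun i => wpow (y i) (-z / 2)) := by
      convert MStripBounded.udv_wpow V V y (-1 / 2) 0 using 6
      push_cast
      ring
    have e3 : MStripBounded Q := by
      convert MStripBounded.udv_wpow T S s (-p) p using 5
      push_cast
      ring
    exact ((((e1 Ua Va a).amp.mul ((e2.amp.mul (e1 U U x)).mul e2.amp)).mul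
      (e1 Ub Vb b).amp).mul e3).trace
  set N := ∑ i, s i ^ p with hN
  have hN0 : 0 ≤ N := Finset.sum_nonneg fun i _ => Real.rpow_nonneg (hs0 i) _
  set α := ∑ i, a i ^ (2 * p) with hα
  set β := ∑ i, b i ^ (2 * p) with hβ
  have hα0 : 0 ≤ α := Finset.sum_nonneg fun i _ => Real.rpow_nonneg (ha i) _
  have hβ0 : 0 ≤ β := Finset.sum_nonneg fun i _ => Real.rpow_nonneg (hb i) _
  have hLeft : ∀ z : ℂ, z.re = 0 → ‖F z‖ ≤ N := by
    intro z hz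
    have hz2 : (-z / 2).re = 0 := by simp [hz]
    have hpz : ((p : ℂ) * z).re = 0 := by simp [hz]
    refine (norm_trace_mul_udv_le hT hS ?_ _).trans ?_
    · refine norm_mul_le_one (norm_mul_le_one ?_ (norm_mul_le_one (norm_mul_le_one ?_ ?_) ?_)) ?_
      · exact norm_amp_udv_le hUa hVa zero_le_one fun i => norm_wpow_le_one (ha i) hpz
      · exact norm_amp_udv_le hV hV zero_le_one fun i => norm_wpow_le_one (hy i) hz2
      · exact norm_udv_le hU hU zero_le_one fun i => norm_wpow_le_one (hx i) hpz
      · exact norm_amp_udv_le hV hV zero_le_one fun i => norm_wpow_le_one (hy i) hz2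
      · exact norm_amp_udv_le hUb hVb zero_le_one fun i => norm_wpow_le_one (hb i) hpz
    · refine Finset.sum_le_sum fun i _ => (norm_wpow_le (hs0 i) _).trans_eq ?_
      simp [hz]
  -- Splitting X^(pz) into two equal halves and applying Cauchy–Schwarz reduces to `hs_amp_mul_le`,
  -- once as it stands and once for the adjoint with z conjugated.
  have hRight : ∀ z : ℂ, z.re = 1 → ‖F z‖ ≤ √α * √β := by
    intro z hz
    set X2 := udv U U (fun i => wpow (x i) (p * z / 2)) with hX2
    set R := udv V V (fun i => wpow (y i) (-z / 2)) with hR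
    have hXX : udv U U (fun i => wpow (x i) (p * z)) = X2 * X2 := by
      rw [udv_wpow_mul hU]
      congr 2
      ext i
      congr 1
      ring
    have e : F z = ((amp n (udv Ua Va (fun i => wpow (a i) (p * z))) * amp n R * X2) *
        ((X2 * amp n R * amp n (udv Ub Vb (fun i => wpow (b i) (p * z)))) * Q z)).trace := by
      simp only [hF]
      rw [hXX]
      simp only [Matrix.mul_assoc, hR]
    have hQ1 : ‖Q z‖ ≤ 1 :=
      norm_udv_le hT hS zero_le_one fun i => norm_wpow_le_one (hs0 i) (by simp [hz])
    rw [e]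
    refine (norm_trace_mul_le _ _).trans ?_
    refine mul_le_mul (Real.sqrt_le_sqrt ?_) (Real.sqrt_le_sqrt ?_) (Real.sqrt_nonneg _)
      (Real.sqrt_nonneg _)
    · exact hs_amp_mul_le hU hV hy hp0 hP hUa hVa ha hz
    · refine (hs_mul_le' _ hQ1).trans ?_
      rw [← hs_conjTranspose, conjTranspose_mul, conjTranspose_mul, amp_conjTranspose,
        amp_conjTranspose, conjTranspose_udv_wpow, conjTranspose_udv_wpow,
        conjTranspose_udv_wpow, ← Matrix.mul_assoc]
      have := hs_amp_mul_le hU hV hy hp0 hP hVb hUb hb (z := star z) (by simpa using hz)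
      simpa using this
  have hval : F ((1 / p : ℝ) : ℂ) = (N : ℂ) := by
    have hpp : (p : ℂ) * ((1 / p : ℝ) : ℂ) = 1 := by
      push_cast
      field_simp
    have hh : -((1 / p : ℝ) : ℂ) / 2 = -(1 / p) / 2 := by push_cast; ring
    simp only [hF, hpp, hh]
    rw [udv_wpow_one _ _ ha, udv_wpow_one _ _ hb, udv_wpow_one _ _ hx, ← hYdef, hY, hQ,
      ← udv_wpow_one _ _ hs0, udv_wpow_mul hT, trace_udv_self hS, hN]
    push_cast
    refine Finset.sum_congr rfl fun i _ => ?_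
    have : (1 : ℂ) + p * (1 - 1 / (p : ℂ)) = (p : ℝ) := by field_simp; ring
    rw [this, wpow_ofReal' (hs0 i) hp0.ne']
  have h1p : 1 / p ≤ 1 := by rw [div_le_one hp0]; exact hp
  have key := hFs.three_lines one_pos le_rfl hLeft hRight (t := 1 / p) (by positivity) h1p
  rw [hval, div_one, Complex.norm_real, Real.norm_of_nonneg hN0] at key
  rw [hY, schattenNorm_udv hS hT, schattenNorm_udv hUa hVa, schattenNorm_udv hUb hVb]
  have ea : ∑ i, ‖(a i : ℂ)‖ ^ (2 * p) = α :=
    Finset.sum_congr rfl fun i _ => by simp [abs_of_nonneg (ha i)]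
  have eb : ∑ i, ‖(b i : ℂ)‖ ^ (2 * p) = β :=
    Finset.sum_congr rfl fun i _ => by simp [abs_of_nonneg (hb i)]
  have es : ∑ i, ‖(s i : ℂ)‖ ^ p = N :=
    Finset.sum_congr rfl fun i _ => by simp [abs_of_nonneg (hs0 i)]
  rw [ea, eb, es]
  have hright : (√α * √β) ^ (1 / p) = α ^ (1 / (2 * p)) * β ^ (1 / (2 * p)) := by
    rw [Real.mul_rpow (Real.sqrt_nonneg _) (Real.sqrt_nonneg _), Real.sqrt_eq_rpow,
      Real.sqrt_eq_rpow, ← Real.rpow_mul hα0, ← Real.rpow_mul hβ0]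
    congr 2 <;> field_simp
  rw [← hright]
  rcases hN0.eq_or_lt with h0 | hpos
  · rw [← h0, Real.zero_rpow (by positivity)]
    positivity
  · have h2 : N = N ^ (1 - 1 / p) * N ^ (1 / p) := by
      rw [← Real.rpow_add hpos]; simp
    rw [h2] at key
    refine le_of_mul_le_mul_left ?_ (Real.rpow_pos_of_pos hpos (1 - 1 / p))
    rw [← h2] at key ⊢
    exact key

lemma normInfty_le_one (hU : U ∈ unitaryGroup (Fin m × Fin n) ℂ)
    (hx : ∀ i, 0 ≤ x i) (hV : V ∈ unitaryGroup (Fin m) ℂ) (hy : ∀ i, 0 ≤ y i) (hp : 1 ≤ p)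
    (hP : partialTrace₂ (udv U U (fun i => wpow (x i) p)) = udv V V (fun i => (y i : ℂ))) :
    normInfty p (amp n (udv V V (fun i => wpow (y i) (-(1 / p) / 2))) *
      udv U U (fun i => (x i : ℂ)) * amp n (udv V V (fun i => wpow (y i) (-(1 / p) / 2)))) ≤ 1 := by
  refine Real.sSup_le ?_ zero_le_one
  rintro _ ⟨A, B, -, -, rfl⟩
  exact div_le_one_of_le₀ (schattenNorm_amp_mul_le hU hx hV hy hp hP A B)
    (mul_nonneg (schattenNorm_nonneg _ _) (schattenNorm_nonneg _ _))

/-- Multiplication by the range projection of a marginal. -/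
lemma amp_support_mul (hU : U ∈ unitaryGroup (Fin m × Fin n) ℂ)
    (hV : V ∈ unitaryGroup (Fin m) ℂ) {r : ℝ}
    (hP : partialTrace₂ (udv U U (fun i => wpow (x i) r)) = udv V V (fun i => (y i : ℂ)))
    (z : ℂ) :
    amp n (udv V V (fun i => wpow (y i) 0)) * udv U U (fun i => wpow (x i) z) =
      udv U U (fun i => wpow (x i) z) := by
  -- The zeroth power is the projection onto the support of the marginal, so its complement kills
  -- the marginal and hence every power.
  have h : (1 - udv V V (fun i => wpow (y i) 0)) * partialTrace₂ (udv U U (fun i => wpow (x i) r))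
      = 0 := by
    rw [hP, Matrix.sub_mul, Matrix.one_mul, udv_mul_udv hV, sub_eq_zero]
    congr 1
    ext i
    by_cases h : y i = 0 <;> simp [wpow, h]
  have h2 := amp_mul_udv_wpow_eq_zero hU h z
  rw [amp_sub, amp_one, Matrix.sub_mul, Matrix.one_mul, sub_eq_zero] at h2
  exact h2.symm

end Upper

/-! ### Matching the two bounds at p = 1. -/

section Main

variable {m n : ℕ}

lemma exp_le_normLtLp {X : Matrix (Fin m × Fin n) (Fin m × Fin n) ℂ} (hX : X.PosSemidef)
    (htr : X.trace = 1) {p : ℝ} (hp : 1 ≤ p) :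
    Real.exp ((1 - 1 / p) * (-vnEntropy X + vnEntropy (partialTrace₂ X))) ≤ normLtLp 1 p X := by
  -- The trivial factorization shows that the infimum is over a nonempty set.
  refine le_csInf ⟨_, 1, 1, X, by simp, rfl⟩ ?_
  rintro _ ⟨A, B, Z, h, rfl⟩
  exact exp_le_of_factorization hX htr hp A B Z h

lemma normLtLp_nonneg (t p : ℝ) (X : Matrix (Fin m × Fin n) (Fin m × Fin n) ℂ) :
    0 ≤ normLtLp t p X := by
  refine Real.sInf_nonneg ?_
  rintro _ ⟨A, B, Z, -, rfl⟩
  exact mul_nonneg (mul_nonneg (schattenNorm_nonneg _ _) (schattenNorm_nonneg _ _))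
    (normInfty_nonneg _ _)

lemma normLtLp_le {t p : ℝ} {X Z : Matrix (Fin m × Fin n) (Fin m × Fin n) ℂ}
    {A B : Matrix (Fin m) (Fin m) ℂ} (h : X = amp n A * Z * amp n B) :
    normLtLp t p X ≤ schattenNorm (2 * t) A * schattenNorm (2 * t) B * normInfty p Z := by
  refine csInf_le ⟨0, ?_⟩ ⟨A, B, Z, h, rfl⟩
  rintro _ ⟨A, B, Z, -, rfl⟩
  exact mul_nonneg (mul_nonneg (schattenNorm_nonneg _ _) (schattenNorm_nonneg _ _))
    (normInfty_nonneg _ _)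

variable {U : Matrix (Fin m × Fin n) (Fin m × Fin n) ℂ} {x : Fin m × Fin n → ℝ}
  {V W : Matrix (Fin m) (Fin m) ℂ} {y ξ : Fin m → ℝ} {p : ℝ}

/-- The `(1, p)` norm of a positive matrix is at most `Tr (Tr₂ X ^ p) ^ (1 / p)`. -/
lemma normLtLp_le_sum (hU : U ∈ unitaryGroup (Fin m × Fin n) ℂ)
    (hx : ∀ i, 0 ≤ x i) (hV : V ∈ unitaryGroup (Fin m) ℂ) (hy : ∀ i, 0 ≤ y i) (hp : 1 ≤ p)
    (hP : partialTrace₂ (udv U U (fun i => wpow (x i) p)) = udv V V (fun i => (y i : ℂ))) :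
    normLtLp 1 p (udv U U (fun i => (x i : ℂ))) ≤ ∑ i, y i ^ (1 / p) := by
  have hp0 : 0 < p := by linarith
  -- `A` is P^(1/2p) and `R` its inverse on the support of `P`. Sandwiching `X` by the support
  -- projection does not change it, so this is a genuine factorization even when `P` is singular.
  set A := udv V V (fun i => wpow (y i) (1 / p / 2)) with hA
  set R := udv V V (fun i => wpow (y i) (-(1 / p) / 2)) with hR
  set X := udv U U (fun i => (x i : ℂ)) with hX
  have hAR : A * R = udv V V (fun i => wpow (y i) 0) := by
    rw [udv_wpow_mul hV]
    congr 2
    ext i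
    congr 1
    ring
  have hRA : R * A = udv V V (fun i => wpow (y i) 0) := by
    rw [udv_wpow_mul hV]
    congr 2
    ext i
    congr 1
    ring
  have hs : amp n (udv V V (fun i => wpow (y i) 0)) * X = X := by
    rw [hX, ← udv_wpow_one _ _ hx]
    exact amp_support_mul hU hV hP 1
  have hs' : X * amp n (udv V V (fun i => wpow (y i) 0)) = X := by
    have h := congrArg conjTranspose hs
    have hXh : Xᴴ = X := (posSemidef_udv U hx).1.eq
    rwa [conjTranspose_mul, hXh, amp_conjTranspose, conjTranspose_udv_wpow, star_zero] at h
  have hfac : X = amp n A * (amp n R * X * amp n R) * amp n A := by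
    calc X = amp n (A * R) * X * amp n (R * A) := by rw [hAR, hRA, hs, hs']
      _ = _ := by rw [amp_mul, amp_mul]; simp only [Matrix.mul_assoc]
  refine (normLtLp_le hfac).trans ?_
  have hsA : schattenNorm (2 * 1) A = (∑ i, y i ^ (1 / p)) ^ (1 / 2 : ℝ) := by
    rw [hA, schattenNorm_udv hV hV, mul_one]
    congr 1
    refine Finset.sum_congr rfl fun i _ => ?_
    have e : (1 / p / 2 : ℂ) = ((1 / p / 2 : ℝ) : ℂ) := by push_cast; rfl
    rw [e, norm_wpow' (hy i) (by rw [Complex.ofReal_re]; positivity), Complex.ofReal_re,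
      ← Real.rpow_mul (hy i)]
    congr 1
    ring
  have hS0 : 0 ≤ ∑ i, y i ^ (1 / p) := Finset.sum_nonneg fun i _ => Real.rpow_nonneg (hy i) _
  rw [hsA, ← Real.sqrt_eq_rpow, Real.mul_self_sqrt hS0]
  exact mul_le_of_le_one_right hS0 (normInfty_le_one hU hx hV hy hp hP)

/-- A reverse Hölder inequality for the marginal of a power against powers of the marginal. -/
lemma sum_rpow_le (hU : U ∈ unitaryGroup (Fin m × Fin n) ℂ)
    (hV : V ∈ unitaryGroup (Fin m) ℂ) (hy : ∀ i, 0 ≤ y i) (hp : 1 ≤ p)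
    (hP : partialTrace₂ (udv U U (fun i => wpow (x i) p)) = udv V V (fun i => (y i : ℂ)))
    (hW : W ∈ unitaryGroup (Fin m) ℂ) (hξ : ∀ i, 0 ≤ ξ i) (hξ1 : ∑ i, ξ i = 1)
    (hX1 : partialTrace₂ (udv U U (fun i => wpow (x i) (1 : ℝ))) =
      udv W W (fun i => (ξ i : ℂ))) :
    (∑ i, y i ^ (1 / p)) ^ p ≤ (amp n (udv W W (fun i => wpow (ξ i) (1 - p))) *
      udv U U (fun i => wpow (x i) p)).trace.re := by
  have hp0 : 0 < p := by linarith
  set M : Matrix (Fin m) (Fin m) ℂ := Wᴴ * V with hM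
  have hMu : M ∈ unitaryGroup (Fin m) ℂ := mul_mem (conjTranspose_mem_unitary hW) hV
  -- The support of the marginal of X^p lies in that of `X₁`, so eigenvectors of `X₁` with
  -- eigenvalue 0 meet only eigenvectors of `P` with eigenvalue 0.
  have hsupp : ∀ i j, ξ i = 0 → ‖M i j‖ ^ 2 * y j = 0 := by
    intro i j hi
    have h1 : udv W W (fun i => wpow (ξ i) 0) * udv V V (fun i => (y i : ℂ)) =
        udv V V (fun i => (y i : ℂ)) := by
      rw [← hP, ← partialTrace₂_amp_mul, amp_support_mul hU hW hX1]
    have h2 : diagonal (fun i => wpow (ξ i) 0) * (M * diagonal (fun i => (y i : ℂ))) =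
        M * diagonal (fun i => (y i : ℂ)) := by
      have h := congrArg (fun K => Wᴴ * K * V) h1
      simp only [udv] at h
      calc _ = (Wᴴ * W) * diagonal (fun i => wpow (ξ i) 0) * Wᴴ *
            (V * diagonal (fun i => (y i : ℂ)) * (Vᴴ * V)) := by
            rw [mem_unitary_iff.1 hW, mem_unitary_iff.1 hV, hM]
            simp only [Matrix.mul_assoc, Matrix.one_mul, Matrix.mul_one]
        _ = Wᴴ * (V * diagonal (fun i => (y i : ℂ)) * Vᴴ) * V := by
            rw [← h]
            simp only [Matrix.mul_assoc]
        _ = M * diagonal (fun i => (y i : ℂ)) * (Vᴴ * V) := by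
            rw [hM]; simp only [Matrix.mul_assoc]
        _ = _ := by rw [mem_unitary_iff.1 hV, Matrix.mul_one]
    have h3 := congrFun (congrFun h2 i) j
    rw [diagonal_mul, hi, wpow_zero_left, zero_mul, mul_diagonal] at h3
    rcases mul_eq_zero.1 h3.symm with h | h
    · simp [h]
    · have : y j = 0 := by exact_mod_cast h
      simp [this]
  -- The explicit case split matters at p = 1, where the real power `0 ^ 0` is 1 but `wpow` gives 0.
  set w : Fin m → ℝ := fun i => if ξ i = 0 then 0 else ξ i ^ (1 - p) with hw
  have hw0 : ∀ i, 0 ≤ w i := fun i => by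
    simp only [hw]
    split_ifs
    · exact le_rfl
    · exact Real.rpow_nonneg (hξ i) _
  have hww : ∀ i, wpow (ξ i) (1 - p) = (w i : ℂ) := fun i => by
    by_cases h : ξ i = 0
    · simp [hw, h]
    · have := wpow_ofReal (lt_of_le_of_ne (hξ i) (Ne.symm h)) (1 - p)
      push_cast at this
      simp [hw, h, this]
  have htr : (amp n (udv W W (fun i => wpow (ξ i) (1 - p))) *
      udv U U (fun i => wpow (x i) p)).trace.re =
      ∑ q : Fin m × Fin m, ‖M q.1 q.2‖ ^ 2 * (y q.2 * w q.1) := by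
    have : (amp n (udv W W (fun i => wpow (ξ i) (1 - p))) *
        udv U U (fun i => wpow (x i) p)).trace =
        ((∑ q : Fin m × Fin m, ‖M q.1 q.2‖ ^ 2 * (y q.2 * w q.1) : ℝ) : ℂ) := by
      rw [trace_amp_mul, hP, trace_udv_mul, Fintype.sum_prod_type]
      push_cast
      refine Finset.sum_congr rfl fun i _ => ?_
      have e : Wᴴ * udv V V (fun i => (y i : ℂ)) * W =
          M * diagonal (fun i => (y i : ℂ)) * Mᴴ := by
        simp only [udv, hM, conjTranspose_mul, conjTranspose_conjTranspose, Matrix.mul_assoc]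
      rw [e, mul_apply, Finset.mul_sum]
      refine Finset.sum_congr rfl fun j _ => ?_
      rw [mul_diagonal, conjTranspose_apply, ← Complex.mul_conj', Complex.star_def, hww]
      ring
    rw [this, Complex.ofReal_re]
  rw [htr]
  have hsum : ∑ i, y i ^ (1 / p) = ∑ q : Fin m × Fin m, ‖M q.1 q.2‖ ^ 2 * y q.2 ^ (1 / p) := by
    rw [Fintype.sum_prod_type, Finset.sum_comm]
    refine Finset.sum_congr rfl fun j _ => ?_
    dsimp only
    rw [← Finset.sum_mul, sum_norm_sq_col hMu, one_mul]
  rw [hsum]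
  set G := ∑ q : Fin m × Fin m, ‖M q.1 q.2‖ ^ 2 * (y q.2 * w q.1) with hG
  have hG0 : 0 ≤ G := Finset.sum_nonneg fun q _ =>
    mul_nonneg (by positivity) (mul_nonneg (hy _) (hw0 _))
  suffices hmain : ∑ q : Fin m × Fin m, ‖M q.1 q.2‖ ^ 2 * y q.2 ^ (1 / p) ≤ G ^ (1 / p) by
    have h := Real.rpow_le_rpow (Finset.sum_nonneg fun q _ =>
      mul_nonneg (by positivity) (Real.rpow_nonneg (hy _) _)) hmain hp0.le
    rwa [← Real.rpow_mul hG0, one_div_mul_cancel hp0.ne', Real.rpow_one] at h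
  -- Hölder with t = 1/p, using (y ξ^(1-p))^(1/p) ξ^(1-1/p) = y^(1/p) wherever ξ > 0.
  refine le_trans (Finset.sum_le_sum fun q _ => ?_)
    (sum_weighted_rpow_le (c := fun q : Fin m × Fin m => ‖M q.1 q.2‖ ^ 2)
      (u := fun q => y q.2 * w q.1) (v := fun q => ξ q.1) (t := 1 / p)
      (fun _ => by positivity) (fun q => mul_nonneg (hy _) (hw0 _)) (fun q => hξ _)
      (by positivity) (by rw [div_le_one hp0]; exact hp) le_rfl ?_)
  · rcases (hξ q.1).eq_or_lt with h | h
    · have : ‖M q.1 q.2‖ ^ 2 * y q.2 ^ (1 / p) = 0 := by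
        rcases mul_eq_zero.1 (hsupp q.1 q.2 h.symm) with h | h
        · rw [h, zero_mul]
        · rw [h, Real.zero_rpow (by positivity), mul_zero]
      rw [this]
      exact mul_nonneg (by positivity) (mul_nonneg
        (Real.rpow_nonneg (mul_nonneg (hy _) (hw0 _)) _) (Real.rpow_nonneg (hξ _) _))
    · refine le_of_eq ?_
      congr 1
      have e : w q.1 = ξ q.1 ^ (1 - p) := if_neg h.ne'
      rw [e, Real.mul_rpow (hy _) (by positivity), ← Real.rpow_mul h.le, mul_assoc,
        ← Real.rpow_add h]
      have : (1 - p) * (1 / p) + (1 - 1 / p) = 0 := by field_simp; ring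
      rw [this, Real.rpow_zero, mul_one]
  · rw [Fintype.sum_prod_type]
    refine le_of_eq ?_
    rw [← hξ1]
    refine Finset.sum_congr rfl fun i _ => ?_
    dsimp only
    rw [← Finset.sum_mul, sum_norm_sq_row hMu, one_mul]

/-- The trace functional `Tr X ^ z X₁ ^ (1 - z)` differentiates to the conditional entropy. -/
lemma hasDerivAt_trace_mul_rpow (hU : U ∈ unitaryGroup (Fin m × Fin n) ℂ)
    (hx : ∀ i, 0 ≤ x i) (hW : W ∈ unitaryGroup (Fin m) ℂ)
    (hX1 : partialTrace₂ (udv U U (fun i => (x i : ℂ))) = udv W W (fun i => (ξ i : ℂ))) :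
    HasDerivAt (fun p : ℝ => (amp n (udv W W (fun i => wpow (ξ i) (1 - p))) *
      udv U U (fun i => wpow (x i) p)).trace.re)
      (∑ i, x i * Real.log (x i) - ∑ i, ξ i * Real.log (ξ i)) 1 := by
  have hX1' : partialTrace₂ (udv U U (fun i => wpow (x i) (1 : ℝ))) =
      udv W W (fun i => (ξ i : ℂ)) := by
    rw [Complex.ofReal_one, udv_wpow_one _ _ hx, hX1]
  have h := ((MHasDerivAt.udv_wpow W W ξ (-1) 1 1).amp.mul
    (MHasDerivAt.udv_wpow U U x 1 0 1)).trace (ι := Fin m × Fin n)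
  have hval : (amp n (udv W W (fun i => -1 * (Real.log (ξ i) * wpow (ξ i) (-1 * 1 + 1)))) *
      udv U U (fun i => wpow (x i) (1 * 1 + 0)) +
      amp n (udv W W (fun i => wpow (ξ i) (-1 * 1 + 1))) *
      udv U U (fun i => 1 * (Real.log (x i) * wpow (x i) (1 * 1 + 0)))).trace =
      ((∑ i, x i * Real.log (x i) - ∑ i, ξ i * Real.log (ξ i) : ℝ) : ℂ) := by
    have e0 : (-1 * 1 + 1 : ℂ) = 0 := by norm_num
    have e1 : (1 * 1 + 0 : ℂ) = 1 := by norm_num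
    simp only [e0, e1]
    have h2 : udv U U (fun i => 1 * (Real.log (x i) * wpow (x i) 1)) =
        udv U U (fun i => wpow (x i) 1) * udv U U (fun i => (Real.log (x i) : ℂ)) := by
      rw [udv_mul_udv hU]
      congr 1
      ext i
      simp [mul_comm]
    -- At p = 1 the power of `X₁` is its support projection and drops out against `X`; the other
    -- term collapses to Tr X₁ log X₁ through the partial trace.
    rw [trace_add, h2, ← Matrix.mul_assoc, amp_support_mul hU hW hX1', ← h2, trace_udv_self hU,
      udv_wpow_one _ _ hx, trace_amp_mul, hX1, udv_mul_udv hW, trace_udv_self hW]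
    push_cast
    rw [add_comm, sub_eq_add_neg, ← Finset.sum_neg_distrib]
    congr 1
    · refine Finset.sum_congr rfl fun i _ => ?_
      rw [wpow_one (hx i)]
      ring
    · refine Finset.sum_congr rfl fun i _ => ?_
      rw [Pi.mul_apply]
      by_cases h : ξ i = 0
      · simp [h]
      · simp [wpow, h, mul_comm]
  rw [hval] at h
  generalize ∑ i, x i * Real.log (x i) - ∑ i, ξ i * Real.log (ξ i) = c at h ⊢
  have h3 := HasDerivAt.real_of_complex (z := 1) (by simpa using h)
  rw [Complex.ofReal_re] at h3
  convert h3 using 4 with p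
  simp [sub_eq_neg_add]

/-- The three functions agree at `a`, so their slopes to the right are ordered and the outer ones
share a limit. Only the right side is controlled, hence `Set.Ici`. -/
lemma hasDerivWithinAt_of_squeeze {f g l : ℝ → ℝ} {c a : ℝ} (hl : HasDerivAt l c a)
    (hg : HasDerivAt g c a) (h0 : l a = g a) (h1 : ∀ t, a ≤ t → l t ≤ f t)
    (h2 : ∀ t, a ≤ t → f t ≤ g t) : HasDerivWithinAt f c (Set.Ici a) a := by
  have hfa : f a = l a := le_antisymm ((h2 a le_rfl).trans h0.ge) (h1 a le_rfl)
  rw [← hasDerivWithinAt_Ioi_iff_Ici, hasDerivWithinAt_iff_tendsto_slope' Set.self_notMem_Ioi]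
  have hl' := hasDerivWithinAt_iff_tendsto_slope' (s := Set.Ioi a) Set.self_notMem_Ioi |>.1
    hl.hasDerivWithinAt
  have hg' := hasDerivWithinAt_iff_tendsto_slope' (s := Set.Ioi a) Set.self_notMem_Ioi |>.1
    hg.hasDerivWithinAt
  refine tendsto_of_tendsto_of_tendsto_of_le_of_le' hl' hg' ?_ ?_
  · filter_upwards [self_mem_nhdsWithin] with t (ht : a < t)
    rw [slope_def_field, slope_def_field, hfa]
    have := h1 t ht.le
    have := sub_pos.2 ht
    gcongr
  · filter_upwards [self_mem_nhdsWithin] with t (ht : a < t)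
    rw [slope_def_field, slope_def_field, hfa, h0]
    have := h2 t ht.le
    have := sub_pos.2 ht
    gcongr

end Main

end OperatorSpaceEntropy

open OperatorSpaceEntropy in
theorem mainTheorem9 (m n : ℕ) (X : Matrix (Fin m × Fin n) (Fin m × Fin n) ℂ)
    (hX : X.PosSemidef) (htr : X.trace = 1) :
    HasDerivWithinAt
      (fun p : ℝ => OperatorSpaceEntropy.normLtLp 1 p X ^ p)
      (-OperatorSpaceEntropy.vnEntropy X
        + OperatorSpaceEntropy.vnEntropy (OperatorSpaceEntropy.partialTrace₂ X))
      (Set.Ici 1) 1 := by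
  obtain ⟨U, hU, x, hx, hXx⟩ := exists_udv_of_posSemidef hX
  obtain ⟨W, hW, ξ, hξ, hX1⟩ := exists_udv_of_posSemidef (posSemidef_partialTrace₂ hX)
  have hξ1 : ∑ i, ξ i = 1 := sum_eq_one_of_trace_udv hW (by rw [← hX1, trace_partialTrace₂, htr])
  set L := -vnEntropy X + vnEntropy (partialTrace₂ X) with hL
  have hLval : L = ∑ i, x i * Real.log (x i) - ∑ i, ξ i * Real.log (ξ i) := by
    rw [hL, hX1, hXx, vnEntropy_udv hU, vnEntropy_udv hW]
    ring
  have hX1' : partialTrace₂ (udv U U (fun i => wpow (x i) (1 : ℝ))) =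
      udv W W (fun i => (ξ i : ℂ)) := by
    rw [Complex.ofReal_one, udv_wpow_one _ _ hx, ← hXx, hX1]
  have hg := hasDerivAt_trace_mul_rpow hU hx hW (by rw [← hXx, hX1])
  rw [← hLval] at hg
  have hl : HasDerivAt (fun p : ℝ => Real.exp ((p - 1) * L)) L 1 := by
    have := (((hasDerivAt_id' (1 : ℝ)).sub_const 1).mul_const L).exp
    simpa using this
  refine hasDerivWithinAt_of_squeeze hl hg ?_ ?_ ?_
  · have e : amp n (udv W W (fun i => wpow (ξ i) (1 - (1 : ℝ)))) *
        udv U U (fun i => wpow (x i) (1 : ℝ)) = X := by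
      rw [Complex.ofReal_one, sub_self, amp_support_mul hU hW hX1', udv_wpow_one _ _ hx, hXx]
    rw [e, htr]
    simp
  · intro p hp
    have hp0 : 0 < p := by linarith
    -- Raising to the power `p` turns the exponent 1 - 1/p into p - 1.
    have h := Real.rpow_le_rpow (Real.exp_nonneg _) (exp_le_normLtLp hX htr hp) hp0.le
    rw [← Real.exp_mul] at h
    refine le_trans (le_of_eq ?_) h
    congr 1
    rw [← hL]
    field_simp
  · intro p hp
    have hp0 : 0 < p := by linarith
    have hPpos : (partialTrace₂ (udv U U (fun i => wpow (x i) p))).PosSemidef := by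
      have e : (fun i => wpow (x i) p) = fun i => ((x i ^ p : ℝ) : ℂ) :=
        funext fun i => wpow_ofReal' (hx i) hp0.ne'
      rw [e]
      exact posSemidef_partialTrace₂ (posSemidef_udv U fun i => Real.rpow_nonneg (hx i) p)
    obtain ⟨V, hV, y, hy, hP⟩ := exists_udv_of_posSemidef hPpos
    have h1 := normLtLp_le_sum hU hx hV hy hp hP
    rw [← hXx] at h1
    exact (Real.rpow_le_rpow (normLtLp_nonneg _ _ _) h1 hp0.le).trans
      (sum_rpow_le hU hV hy hp hP hW hξ hξ1 hX1')
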